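/- \textbf{Theorem.} On a word RAM with words of $w \ge \lg(n+1)$ bits, a subset $S$ of the universe $\{1,\dots,n\}$ can be maintained using $n+o(n)$ bits so that the operations insert$(i)$, delete$(i)$, search$(i)$ (is $i\in S$?) and findany (return some element of $S$, or NIL if $S=\emptyset$) all take worst-case constant time, all elements of $S$ can be enumerated (in no particular order, each exactly once) in $O(k+1)$ time where $k=|S|$, and the structure can be initialized to $S=\emptyset$ in $O(1)$ time from arbitrary memory contents. Precisely: the machine has a fixed number of registers and a random-access memory of $w$-bit words; in unit time it copies a constant word into a register, loads or stores a memory word, adds, subtracts, multiplies (modulo $2^w$), divides with remainder, takes bitwise AND, OR or XOR, shifts, makes a conditional jump on $<$ or $=$, or writes a word to a write-only output. There are constants $R,K,T,w_0$, a function $r:\mathbb N\to\mathbb N$ with $r(n)=o(n)$, and fixed programs for initialization and for the five operations (the same for all $n$ and $w$), using $R+1$ registers and $K$ constant words, such that for every word size $w\ge w_0$ there is a choice of the $K$ constant words, depending only on $w$, for which the following holds for every $n<2^w$. For some number $m$ of memory words such that registers, constants and memory together occupy $$(R+1+K+m)\,w \;\le\; n+r(n)+T\,w$$ bits (so $n+o(n)$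 bits whenever $w=o(n)$, in particular for $w=\Theta(\lg n)$; the term $Tw$ accounts for $O(1)$ whole words), initialization takes at most $T$ steps given $n$ and any initial contents of registers and memory, and after it, following any sequence of operations, each insert, delete, search and findany is answered correctly within $T$ steps and each enumeration of a set of $k$ elements is correct and takes at most $T(k+1)$ steps. NIL is returned as $0$; the arguments of insert, delete and search are elements of $\{1,\dots,n\}$. -/

import Mathlib

open Asymptotics Filter

namespace WordRAM

/-- The binary word instructions of a word RAM. -/
inductive BinOp where
  | add | sub | mul | div | mod | and | or | xor | shl | shr

/-- Arithmetic is modulo `2 ^ w` on unsigned `w`-bit words; `div`, `mod` are the quotient and the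
remainder; `shl`, `shr` shift the first word by the number of positions given by the second. -/
def BinOp.eval {w : ℕ} : BinOp → BitVec w → BitVec w → BitVec w
  | .add, x, y => x + y
  | .sub, x, y => x - y
  | .mul, x, y => x * y
  | .div, x, y => x / y
  | .mod, x, y => x % y
  | .and, x, y => x &&& y
  | .or,  x, y => x ||| y
  | .xor, x, y => x ^^^ y
  | .shl, x, y => x <<< y.toNat
  | .shr, x, y => x >>> y.toNat

/-- The instructions of a word RAM with registers `0, …, R` and `K` read-only constant words.
They do not mention the word size. -/
inductive Instr (R K : ℕ) where
  /-- `const d k` : write the `k`-th constant word into register `d` -/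
  | const (d : Fin (R + 1)) (k : Fin K)
  /-- `op o d a b` : write `a o b` into register `d` -/
  | op (o : BinOp) (d a b : Fin (R + 1))
  /-- `load d a` : read the memory word whose address is in register `a` into register `d` -/
  | load (d a : Fin (R + 1))
  /-- `store a b` : write register `b` to the memory word whose address is in register `a` -/
  | store (a b : Fin (R + 1))
  /-- `jumpLt a b l` : go to line `l` if register `a` is less than register `b` -/
  | jumpLt (a b : Fin (R + 1)) (l : ℕ)
  /-- `jumpEq a b l` : go to line `l` if register `a` is equal to register `b` -/
  | jumpEq (a b : Fin (R + 1)) (l : ℕ)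
  /-- `emit a` : write register `a` to the write-only output -/
  | emit (a : Fin (R + 1))
  | halt

abbrev Program (R K : ℕ) := List (Instr R K)

/-- The whole rewritable workspace of a machine with `w`-bit words: `R + 1` registers and `m` words
of random-access memory. -/
@[ext]
structure State (w R m : ℕ) where
  reg : Fin (R + 1) → BitVec w
  mem : Fin m → BitVec w

/-- A configuration during a run: workspace, program counter, and the words written so far to the
write-only output (the most recent one first). -/
@[ext]
structure Config (w R m : ℕ) where
  state : State w R m
  pc : ℕ
  out : List (BitVec w)

variable {w R K m : ℕ}

/-- Write `v` into register `d` and go to the next line. -/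
def Config.setReg (c : Config w R m) (d : Fin (R + 1)) (v : BitVec w) : Config w R m where
  state := { reg := Function.update c.state.reg d v, mem := c.state.mem }
  pc := c.pc + 1
  out := c.out

/-- The effect of one instruction, where `κ` holds the constant words. There is no next
configuration after `halt`, and none if an address outside the `m` words of memory is accessed. -/
def Instr.exec (κ : Fin K → BitVec w) (c : Config w R m) : Instr R K → Option (Config w R m)
  | .const d k => some (c.setReg d (κ k))
  | .op o d a b => some (c.setReg d (o.eval (c.state.reg a) (c.state.reg b)))
  | .load d a =>
      if h : (c.state.reg a).toNat < m then
        some (c.setReg d (c.state.mem ⟨(c.state.reg a).toNat, h⟩))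
      else none
  | .store a b =>
      if h : (c.state.reg a).toNat < m then
        some
          { state :=
              { reg := c.state.reg
                mem := Function.update c.state.mem ⟨(c.state.reg a).toNat, h⟩ (c.state.reg b) }
            pc := c.pc + 1
            out := c.out }
      else none
  | .jumpLt a b l =>
      some { c with pc := if (c.state.reg a).toNat < (c.state.reg b).toNat then l else c.pc + 1 }
  | .jumpEq a b l =>
      some { c with pc := if c.state.reg a = c.state.reg b then l else c.pc + 1 }
  | .emit a => some { c with pc := c.pc + 1, out := c.state.reg a :: c.out }
  | .halt => none

/-- One step of a program (each instruction takes unit time). -/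
def step (κ : Fin K → BitVec w) (P : Program R K) (c : Config w R m) : Option (Config w R m) :=
  P[c.pc]?.bind (Instr.exec κ c)

/-- The configuration after exactly `t` steps. -/
def run (κ : Fin K → BitVec w) (P : Program R K) : ℕ → Config w R m → Option (Config w R m)
  | 0, c => some c
  | t + 1, c => (step κ P c).bind (run κ P t)

/-- The configuration in which a program is called on workspace `s` with argument `a`:
the argument is placed in register `0`. -/
def call (s : State w R m) (a : BitVec w) : Config w R m where
  state := { reg := Function.update s.reg 0 a, mem := s.mem }
  pc := 0
  out := []

/-- Called on workspace `s` with argument `a`, the program reaches `halt` after at most `T` steps,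
and then the workspace and the list of words output satisfy `post`. -/
def Completes (κ : Fin K → BitVec w) (P : Program R K) (T : ℕ) (s : State w R m)
    (a : BitVec w) (post : State w R m → List (BitVec w) → Prop) : Prop :=
  ∃ t ≤ T, ∃ c : Config w R m,
    run κ P t (call s a) = some c ∧ P[c.pc]? = some Instr.halt ∧ post c.state c.out

/-- The result of a call is the content of register `0`. -/
def State.result (s : State w R m) : ℕ := (s.reg 0).toNat

/-- The programs for the operations of a set data structure with `findany`. -/
structure SetPrograms (R K : ℕ) where
  setup : Program R K
  insert : Program R K
  delete : Program R K
  search : Program R K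
  findany : Program R K
  enumerate : Program R K

/-- On a machine with `w`-bit words, constant words `κ`, `R + 1` registers and `m` memory words, the
programs maintain a subset of the universe `{1, …, n}`. Here `Rep s S` says that the workspace
`s` represents the set `S`. All
operations take at most `T` steps in the worst case, and the enumeration takes at most
`T * (k + 1)` steps on a set of `k` elements. -/
def SetPrograms.Maintains (D : SetPrograms R K) (κ : Fin K → BitVec w) (n m T : ℕ) : Prop :=
  ∃ Rep : State w R m → Finset ℕ → Prop,
    -- initialization with argument `n`, from arbitrary contents of the workspace
    (∀ s, Completes κ D.setup T s (BitVec.ofNat w n) fun s' _ => Rep s' ∅) ∧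
    ∀ (S : Finset ℕ) (s : State w R m), S ⊆ Finset.Icc 1 n → Rep s S →
      (∀ i ∈ Finset.Icc 1 n,
        Completes κ D.insert T s (BitVec.ofNat w i) fun s' _ => Rep s' (Insert.insert i S)) ∧
      (∀ i ∈ Finset.Icc 1 n,
        Completes κ D.delete T s (BitVec.ofNat w i) fun s' _ => Rep s' (S.erase i)) ∧
      (∀ i ∈ Finset.Icc 1 n,
        Completes κ D.search T s (BitVec.ofNat w i) fun s' _ =>
          Rep s' S ∧ s'.result = if i ∈ S then 1 else 0) ∧
      -- the number `0`, which is not in the universe, serves as `NIL`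
      (Completes κ D.findany T s 0 fun s' _ =>
        Rep s' S ∧ (S = ∅ → s'.result = 0) ∧ (S.Nonempty → s'.result ∈ S)) ∧
      -- every element is output exactly once, and nothing else is output
      (Completes κ D.enumerate (T * (S.card + 1)) s 0 fun s' out =>
        Rep s' S ∧ (out.map BitVec.toNat).Nodup ∧ (out.map BitVec.toNat).toFinset = S)

end WordRAM

/-! ### Structured programs and their compilation -/

namespace WordRAM

variable {w R K m : ℕ}

/-! The set is a bit vector of `2 * N` words, grouped into `N` blocks of two words, and only blocks
with a nonzero word count as nonempty. The structure is an in-place variant of the sparse-array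
trick: a barrier `μ`, always equal to the number of nonempty blocks, separates the blocks, and all
bookkeeping except a few registers is hidden inside the blocks themselves.

A block in front of the barrier and one behind it are mates when their first words point to each
other; every other block is its own mate. In front of the barrier a block is nonempty exactly when
it is its own mate, and behind the barrier exactly when it is not. Hence each `e < μ` and its mate
contain exactly one nonempty block between them, namely `mate e`. A nonempty block without a partner
stores its two words in place. A nonempty block behind the barrier keeps its second word in place,
spends its first word on the pointer, and lodges the displaced first word in the second word of its
empty partner. With `μ = 0` every memory represents the empty set, so initialization is free; `mate
0` is a nonempty block whenever `μ > 0`; and running through `e < μ` visits each nonempty block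
once, so the number of rounds is at most the number of elements.

Emptying or filling a block moves the barrier by one, which disturbs only the block it passes, the
block concerned and their mates (`words_remove`, `words_add`). Data written in front of the barrier
may look like a pointer and form an unintended pair; the block behind is then made to point to
itself. A bit is changed by removing its block if nonempty, changing the word, and adding the block
again if nonempty (`wp_updateCmd`).

Elements are extracted from a word through its lowest set bit, whose index is computed in constant
time by division modulo `2 ^ s - 1` and a one-word table (`log_formula`). Correctness of machine
code is reduced to weakest preconditions over natural numbers for loop-free code (`Triple.of_wp`)
and to induction for the loops (`triple_emitWordCmd`, `triple_enumerate_loop`). -/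

/-- Structured programs over the word instructions. -/
inductive Cmd (R K : ℕ) where
  | skip
  | const (d : Fin (R + 1)) (k : Fin K)
  | op (o : BinOp) (d a b : Fin (R + 1))
  | load (d a : Fin (R + 1))
  | store (a b : Fin (R + 1))
  | emit (a : Fin (R + 1))
  | seq (c₁ c₂ : Cmd R K)
  | ifLt (a b : Fin (R + 1)) (c₁ c₂ : Cmd R K)
  | ifEq (a b : Fin (R + 1)) (c₁ c₂ : Cmd R K)
  | whileLt (a b : Fin (R + 1)) (c : Cmd R K)

namespace Cmd

infixr:60 " ;; " => Cmd.seq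

/-- The number of instructions a structured program compiles to. -/
def size : Cmd R K → ℕ
  | skip => 0
  | const _ _ | op _ _ _ _ | load _ _ | store _ _ | emit _ => 1
  | seq c₁ c₂ => c₁.size + c₂.size
  | ifLt _ _ c₁ c₂ | ifEq _ _ c₁ c₂ => 1 + c₂.size + 1 + c₁.size
  | whileLt _ _ c => 2 + c.size + 1

/-- The machine code of a structured program whose first line has number `l`. -/
def compile : Cmd R K → ℕ → List (Instr R K)
  | skip, _ => []
  | const d k, _ => [.const d k]
  | op o d a b, _ => [.op o d a b]
  | load d a, _ => [.load d a]
  | store a b, _ => [.store a b]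
  | emit a, _ => [.emit a]
  | seq c₁ c₂, l => c₁.compile l ++ c₂.compile (l + c₁.size)
  | ifLt a b c₁ c₂, l =>
      .jumpLt a b (l + 1 + c₂.size + 1) :: (c₂.compile (l + 1) ++
        (.jumpEq 0 0 (l + 1 + c₂.size + 1 + c₁.size) :: c₁.compile (l + 1 + c₂.size + 1)))
  | ifEq a b c₁ c₂, l =>
      .jumpEq a b (l + 1 + c₂.size + 1) :: (c₂.compile (l + 1) ++
        (.jumpEq 0 0 (l + 1 + c₂.size + 1 + c₁.size) :: c₁.compile (l + 1 + c₂.size + 1)))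
  | whileLt a b c, l =>
      .jumpLt a b (l + 2) :: .jumpEq 0 0 (l + 2 + c.size + 1) ::
        (c.compile (l + 2) ++ [.jumpEq 0 0 l])

theorem length_compile (c : Cmd R K) (l : ℕ) : (c.compile l).length = c.size := by
  induction c generalizing l <;> simp [compile, size, *] <;> omega

/-- A bound on the running time of a loop-free structured program. -/
def cost : Cmd R K → ℕ
  | skip => 0
  | const _ _ | op _ _ _ _ | load _ _ | store _ _ | emit _ => 1
  | seq c₁ c₂ => c₁.cost + c₂.cost
  | ifLt _ _ c₁ c₂ | ifEq _ _ c₁ c₂ => c₁.cost + c₂.cost + 2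
  | whileLt _ _ _ => 0

/-- The complete machine program of a structured program. -/
def program (c : Cmd R K) : Program R K := c.compile 0 ++ [.halt]

end Cmd

/-! ### Machine semantics on natural numbers -/

/-- A workspace and an output whose words are given as natural numbers. -/
@[ext]
structure NatState (R : ℕ) where
  reg : Fin (R + 1) → ℕ
  mem : ℕ → ℕ
  out : List ℕ

namespace NatState

def setReg (V : NatState R) (d : Fin (R + 1)) (v : ℕ) : NatState R :=
  { V with reg := Function.update V.reg d v }

def setMem (V : NatState R) (a v : ℕ) : NatState R :=
  { V with mem := Function.update V.mem a v }

def write (V : NatState R) (v : ℕ) : NatState R := { V with out := v :: V.out }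

@[simp] theorem reg_setReg (V : NatState R) (d e : Fin (R + 1)) (v : ℕ) :
    (V.setReg d v).reg e = if e = d then v else V.reg e := by
  simp [setReg, Function.update_apply]

@[simp] theorem mem_setReg (V : NatState R) (d : Fin (R + 1)) (v : ℕ) :
    (V.setReg d v).mem = V.mem := rfl

@[simp] theorem reg_setMem (V : NatState R) (a v : ℕ) : (V.setMem a v).reg = V.reg := rfl

@[simp] theorem mem_setMem (V : NatState R) (a v : ℕ) :
    (V.setMem a v).mem = Function.update V.mem a v := rfl

@[simp] theorem reg_write (V : NatState R) (v : ℕ) : (V.write v).reg = V.reg := rfl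

@[simp] theorem out_write (V : NatState R) (v : ℕ) : (V.write v).out = v :: V.out := rfl

/-- The natural numbers in `V` are those in the workspace `s` and the output `o`. -/
structure Models (V : NatState R) (s : State w R m) (o : List (BitVec w)) : Prop where
  reg : ∀ i, (s.reg i).toNat = V.reg i
  mem : ∀ a : Fin m, (s.mem a).toNat = V.mem a
  out : o.map BitVec.toNat = V.out

end NatState

/-- The word operations on natural numbers. -/
def BinOp.natEval (w : ℕ) : BinOp → ℕ → ℕ → ℕ
  | .add, x, y => (x + y) % 2 ^ w
  | .sub, x, y => (2 ^ w - y + x) % 2 ^ w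
  | .mul, x, y => (x * y) % 2 ^ w
  | .div, x, y => x / y
  | .mod, x, y => x % y
  | .and, x, y => x &&& y
  | .or,  x, y => x ||| y
  | .xor, x, y => x ^^^ y
  | .shl, x, y => (x * 2 ^ y) % 2 ^ w
  | .shr, x, y => x / 2 ^ y

theorem BinOp.toNat_eval (o : BinOp) (x y : BitVec w) :
    (o.eval x y).toNat = o.natEval w x.toNat y.toNat := by
  cases o <;> simp [BinOp.eval, BinOp.natEval, Nat.shiftLeft_eq, Nat.shiftRight_eq_div_pow]

theorem run_add (κ : Fin K → BitVec w) (P : Program R K) (t₁ t₂ : ℕ) (c : Config w R m) :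
    run κ P (t₁ + t₂) c = (run κ P t₁ c).bind (run κ P t₂) := by
  induction t₁ generalizing c with
  | zero => simp [run]
  | succ t ih =>
    rw [Nat.add_right_comm]
    simp only [run]
    cases step κ P c <;> simp [ih]

/-- The lines of `P` from line `l` on begin with `L`. -/
def CodeAt (P : Program R K) (l : ℕ) (L : List (Instr R K)) : Prop :=
  ∃ pre post, P = pre ++ (L ++ post) ∧ pre.length = l

theorem CodeAt.head {P : Program R K} {l : ℕ} {i : Instr R K} {L : List (Instr R K)}
    (h : CodeAt P l (i :: L)) : P[l]? = some i := by
  obtain ⟨pre, post, rfl, rfl⟩ := h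
  simp

theorem CodeAt.tail {P : Program R K} {l : ℕ} {i : Instr R K} {L : List (Instr R K)}
    (h : CodeAt P l (i :: L)) : CodeAt P (l + 1) L := by
  obtain ⟨pre, post, rfl, rfl⟩ := h
  exact ⟨pre ++ [i], post, by simp, by simp⟩

theorem CodeAt.left {P : Program R K} {l : ℕ} {L₁ L₂ : List (Instr R K)}
    (h : CodeAt P l (L₁ ++ L₂)) : CodeAt P l L₁ := by
  obtain ⟨pre, post, rfl, rfl⟩ := h
  exact ⟨pre, L₂ ++ post, by simp, rfl⟩

theorem CodeAt.right {P : Program R K} {l : ℕ} {L₁ L₂ : List (Instr R K)}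
    (h : CodeAt P l (L₁ ++ L₂)) : CodeAt P (l + L₁.length) L₂ := by
  obtain ⟨pre, post, rfl, rfl⟩ := h
  exact ⟨pre ++ L₁, post, by simp, by simp⟩

/-! ### Hoare triples for compiled code -/

/-- Wherever the code of `c` is placed, from the contents `V` it runs to its end,
and then `Q` holds for the number of steps and the contents. -/
def Triple (κ : Fin K → BitVec w) (m : ℕ) (c : Cmd R K) (V : NatState R)
    (Q : ℕ → NatState R → Prop) : Prop :=
  ∀ (P : Program R K) (l : ℕ) (s : State w R m) (o : List (BitVec w)), V.Models s o →
    CodeAt P l (c.compile l) →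
    ∃ t s' o' V', run κ P t ⟨s, l, o⟩ = some ⟨s', l + c.size, o'⟩ ∧ V'.Models s' o' ∧ Q t V'

namespace Triple

variable {κ : Fin K → BitVec w} {c c₁ c₂ : Cmd R K} {V : NatState R} {Q Q' : ℕ → NatState R → Prop}
  {a b d : Fin (R + 1)}

theorem mono (h : Triple κ m c V Q) (hQ : ∀ t V', Q t V' → Q' t V') : Triple κ m c V Q' := by
  intro P l s o hs hP
  obtain ⟨t, s', o', V', h₁, h₂, h₃⟩ := h P l s o hs hP
  exact ⟨t, s', o', V', h₁, h₂, hQ _ _ h₃⟩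

/-- In a proof of a triple the contents may be assumed to be words. -/
theorem of_lt (h : (∀ i, V.reg i < 2 ^ w) → (∀ a < m, V.mem a < 2 ^ w) → Triple κ m c V Q) :
    Triple κ m c V Q := by
  intro P l s o hs hP
  refine h (fun i => ?_) (fun a ha => ?_) P l s o hs hP
  · rw [← hs.reg]; exact BitVec.isLt _
  · have := hs.mem ⟨a, ha⟩
    rw [← this]; exact BitVec.isLt _

theorem skip (h : Q 0 V) : Triple κ m .skip V Q :=
  fun _ _ s o hs _ => ⟨0, s, o, V, rfl, hs, h⟩

theorem seq (h : Triple κ m c₁ V fun t₁ V₁ => Triple κ m c₂ V₁ fun t₂ V₂ => Q (t₁ + t₂) V₂) :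
    Triple κ m (c₁ ;; c₂) V Q := by
  intro P l s o hs hP
  obtain ⟨t₁, s₁, o₁, V₁, hr₁, hs₁, h₁⟩ := h P l s o hs hP.left
  have hP₂ := hP.right
  rw [Cmd.length_compile] at hP₂
  obtain ⟨t₂, s₂, o₂, V₂, hr₂, hs₂, h₂⟩ := h₁ P _ s₁ o₁ hs₁ hP₂
  refine ⟨t₁ + t₂, s₂, o₂, V₂, ?_, hs₂, h₂⟩
  rw [run_add, hr₁, Option.bind_some, hr₂, Cmd.size, Nat.add_assoc]

theorem run_one {P : Program R K} {l : ℕ} {i : Instr R K} (s : State w R m)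
    (o : List (BitVec w)) (h : P[l]? = some i) :
    run κ P 1 ⟨s, l, o⟩ = i.exec κ ⟨s, l, o⟩ := by
  simp only [run, step, h, Option.bind_some]
  cases Instr.exec κ ⟨s, l, o⟩ i <;> rfl

theorem const {k : Fin K} (h : Q 1 (V.setReg d (κ k).toNat)) :
    Triple κ m (.const d k) V Q := by
  intro P l s o hs hP
  refine ⟨1, _, _, V.setReg d _, run_one s o hP.head, ⟨fun i => ?_, hs.mem, hs.out⟩, h⟩
  by_cases hi : i = d
  · subst hi; simp
  · simp [hi, hs.reg]

theorem op {f : BinOp} (h : Q 1 (V.setReg d (f.natEval w (V.reg a) (V.reg b)))) :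
    Triple κ m (.op f d a b) V Q := by
  intro P l s o hs hP
  refine ⟨1, _, _, V.setReg d _, run_one s o hP.head, ⟨fun i => ?_, hs.mem, hs.out⟩, h⟩
  by_cases hi : i = d
  · subst hi; simp [BinOp.toNat_eval, hs.reg]
  · simp [hi, hs.reg]

theorem load (ha : V.reg a < m) (h : Q 1 (V.setReg d (V.mem (V.reg a)))) :
    Triple κ m (.load d a) V Q := by
  intro P l s o hs hP
  have ha' : (s.reg a).toNat < m := by rwa [hs.reg]
  refine ⟨1, { reg := Function.update s.reg d (s.mem ⟨_, ha'⟩), mem := s.mem }, o, V.setReg d _, ?_,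
    ⟨fun i => ?_, hs.mem, hs.out⟩, h⟩
  · rw [run_one s o hP.head]
    simp [Instr.exec, ha', Config.setReg, Cmd.size]
  by_cases hi : i = d
  · subst hi; simp [hs.mem, hs.reg]
  · simp [hi, hs.reg]

theorem store (ha : V.reg a < m) (h : Q 1 (V.setMem (V.reg a) (V.reg b))) :
    Triple κ m (.store a b) V Q := by
  intro P l s o hs hP
  have ha' : (s.reg a).toNat < m := by rwa [hs.reg]
  refine ⟨1, { reg := s.reg, mem := Function.update s.mem ⟨_, ha'⟩ (s.reg b) }, o, V.setMem _ _, ?_,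
    ⟨hs.reg, fun i => ?_, hs.out⟩, h⟩
  · rw [run_one s o hP.head]
    simp [Instr.exec, ha', Cmd.size]
  simp only [Function.update_apply, NatState.mem_setMem, Fin.ext_iff, hs.reg]
  split_ifs
  · exact hs.reg b
  · exact hs.mem i

theorem emit (h : Q 1 (V.write (V.reg a))) : Triple κ m (.emit a) V Q := by
  intro P l s o hs hP
  exact ⟨1, _, _, V.write _, run_one s o hP.head, ⟨hs.reg, hs.mem, by simp [hs.reg, hs.out]⟩, h⟩

/-- A register equals itself, so this instruction is the unconditional jump of the compiler. -/
theorem run_jumpEq_self {P : Program R K} {l k : ℕ} (s : State w R m) (o : List (BitVec w))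
    (h : P[l]? = some (.jumpEq 0 0 k)) : run κ P 1 ⟨s, l, o⟩ = some ⟨s, k, o⟩ := by
  rw [run_one s o h]; simp [Instr.exec]

theorem run_jumpLt {P : Program R K} {l k : ℕ} {s : State w R m} {o : List (BitVec w)}
    (hs : V.Models s o) (h : P[l]? = some (.jumpLt a b k)) :
    run κ P 1 ⟨s, l, o⟩ = some ⟨s, if V.reg a < V.reg b then k else l + 1, o⟩ := by
  rw [run_one s o h]; simp [Instr.exec, hs.reg]

theorem run_jumpEq {P : Program R K} {l k : ℕ} {s : State w R m} {o : List (BitVec w)}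
    (hs : V.Models s o) (h : P[l]? = some (.jumpEq a b k)) :
    run κ P 1 ⟨s, l, o⟩ = some ⟨s, if V.reg a = V.reg b then k else l + 1, o⟩ := by
  rw [run_one s o h]; simp [Instr.exec, BitVec.toNat_eq, hs.reg]

/-- The second branch is compiled first and ends in a jump over the first branch, so the overhead is
one step or two. Requiring `Q` for every `t' ≤ t + 2` covers both cases and suits postconditions
that bound the time. -/
theorem branch_aux {p : Prop} [Decidable p] {P : Program R K} {l : ℕ} {s : State w R m}
    {o : List (BitVec w)} (hs : V.Models s o)
    (hr : run κ P 1 ⟨s, l, o⟩ = some ⟨s, if p then l + 1 + c₂.size + 1 else l + 1, o⟩)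
    (hP : CodeAt P (l + 1) (c₂.compile (l + 1) ++
        (.jumpEq 0 0 (l + 1 + c₂.size + 1 + c₁.size) :: c₁.compile (l + 1 + c₂.size + 1))))
    (h₁ : p → Triple κ m c₁ V fun t V' => ∀ t', t' ≤ t + 2 → Q t' V')
    (h₂ : ¬ p → Triple κ m c₂ V fun t V' => ∀ t', t' ≤ t + 2 → Q t' V') :
    ∃ t s' o' V', run κ P t ⟨s, l, o⟩ = some ⟨s', l + (1 + c₂.size + 1 + c₁.size), o'⟩ ∧
      V'.Models s' o' ∧ Q t V' := by
  have hP₁ := hP.right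
  rw [Cmd.length_compile] at hP₁
  by_cases hp : p
  · obtain ⟨t, s', o', V', hr', hs', hQ⟩ := h₁ hp P _ s o hs hP₁.tail
    refine ⟨1 + t, s', o', V', ?_, hs', hQ _ (by omega)⟩
    rw [run_add, hr, Option.bind_some, if_pos hp, hr']
    simp only [Nat.add_assoc]
  · obtain ⟨t, s', o', V', hr', hs', hQ⟩ := h₂ hp P _ s o hs hP.left
    refine ⟨1 + (t + 1), s', o', V', ?_, hs', hQ _ (by omega)⟩
    rw [run_add, hr, Option.bind_some, if_neg hp, run_add, hr', Option.bind_some,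
      run_jumpEq_self _ _ hP₁.head]
    simp only [Nat.add_assoc]

theorem ifLt (h₁ : V.reg a < V.reg b → Triple κ m c₁ V fun t V' => ∀ t', t' ≤ t + 2 → Q t' V')
    (h₂ : ¬ V.reg a < V.reg b → Triple κ m c₂ V fun t V' => ∀ t', t' ≤ t + 2 → Q t' V') :
    Triple κ m (.ifLt a b c₁ c₂) V Q :=
  fun _ _ _ _ hs hP => branch_aux hs (run_jumpLt hs hP.head) hP.tail h₁ h₂

theorem ifEq (h₁ : V.reg a = V.reg b → Triple κ m c₁ V fun t V' => ∀ t', t' ≤ t + 2 → Q t' V')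
    (h₂ : ¬ V.reg a = V.reg b → Triple κ m c₂ V fun t V' => ∀ t', t' ≤ t + 2 → Q t' V') :
    Triple κ m (.ifEq a b c₁ c₂) V Q :=
  fun _ _ _ _ hs hP => branch_aux hs (run_jumpEq hs hP.head) hP.tail h₁ h₂

/-- One unrolling; the two extra steps are the successful test and the jump back. Loops have no
invariant rule: this rule is applied within an induction on the data. -/
theorem whileLt_of_lt (hab : V.reg a < V.reg b)
    (h : Triple κ m c V fun t V' => Triple κ m (.whileLt a b c) V' fun t' V'' =>
      Q (t + t' + 2) V'') :
    Triple κ m (.whileLt a b c) V Q := by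
  intro P l s o hs hP
  have hP₁ := hP.tail.tail.right
  rw [Cmd.length_compile] at hP₁
  obtain ⟨t, s', o', V', hr', hs', hT⟩ := h P _ s o hs hP.tail.tail.left
  obtain ⟨t', s'', o'', V'', hr'', hs'', hQ⟩ := hT P _ s' o' hs' hP
  refine ⟨1 + (t + (1 + t')), s'', o'', V'', ?_, hs'', ?_⟩
  · rw [run_add, run_jumpLt hs hP.head, Option.bind_some, if_pos hab, run_add, hr',
      Option.bind_some, run_add, run_jumpEq_self _ _ hP₁.head, Option.bind_some, hr'']
  · convert hQ using 1; omega

theorem whileLt_of_not_lt (hab : ¬ V.reg a < V.reg b) (h : Q 2 V) :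
    Triple κ m (.whileLt a b c) V Q := by
  intro P l s o hs hP
  refine ⟨1 + 1, s, o, V, ?_, hs, h⟩
  rw [run_add, run_jumpLt hs hP.head, Option.bind_some, if_neg hab,
    run_jumpEq_self _ _ hP.tail.head]
  simp only [Cmd.size, Nat.add_assoc]

/-- A triple for a structured program describes the calls of its machine program. -/
theorem completes {T : ℕ} {s : State w R m} {x : BitVec w} {post}
    (hV : V.Models (call s x).state ([] : List (BitVec w)))
    (h : Triple κ m c V fun t V' => t ≤ T ∧
      ∀ (s' : State w R m) (o : List (BitVec w)), V'.Models s' o → post s' o) :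
    Completes κ c.program T s x post := by
  have hP : CodeAt c.program 0 (c.compile 0) := ⟨[], [.halt], rfl, rfl⟩
  obtain ⟨t, s', o', V', hr, hs', ht, hQ⟩ := h c.program 0 _ _ hV hP
  refine ⟨t, ht, _, hr, ?_, hQ _ _ hs'⟩
  simp [Cmd.program, ← Cmd.length_compile c 0]

end Triple

/-! ### Weakest preconditions of loop-free programs -/

/-- The weakest precondition of a loop-free structured program. -/
def Cmd.wp (κ : Fin K → BitVec w) (m : ℕ) : Cmd R K → (NatState R → Prop) → NatState R → Prop
  | skip, Q, V => Q V
  | const d k, Q, V => Q (V.setReg d (κ k).toNat)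
  | op f d a b, Q, V => Q (V.setReg d (f.natEval w (V.reg a) (V.reg b)))
  | load d a, Q, V => V.reg a < m ∧ Q (V.setReg d (V.mem (V.reg a)))
  | store a b, Q, V => V.reg a < m ∧ Q (V.setMem (V.reg a) (V.reg b))
  | emit a, Q, V => Q (V.write (V.reg a))
  | seq c₁ c₂, Q, V => c₁.wp κ m (c₂.wp κ m Q) V
  | ifLt a b c₁ c₂, Q, V => if V.reg a < V.reg b then c₁.wp κ m Q V else c₂.wp κ m Q V
  | ifEq a b c₁ c₂, Q, V => if V.reg a = V.reg b then c₁.wp κ m Q V else c₂.wp κ m Q V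
  | whileLt _ _ _, _, _ => False

/-- The cost `0` assigned to a loop is harmless because the precondition of a loop is `False`. -/
theorem Triple.of_wp {κ : Fin K → BitVec w} {c : Cmd R K} {V : NatState R}
    {Q : NatState R → Prop} (h : c.wp κ m Q V) :
    Triple κ m c V fun t V' => t ≤ c.cost ∧ Q V' := by
  induction c generalizing V Q with
  | skip => exact .skip ⟨le_rfl, h⟩
  | const d k => exact .const ⟨le_rfl, h⟩
  | op f d a b => exact .op ⟨le_rfl, h⟩
  | load d a => exact .load h.1 ⟨le_rfl, h.2⟩
  | store a b => exact .store h.1 ⟨le_rfl, h.2⟩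
  | emit a => exact .emit ⟨le_rfl, h⟩
  | seq c₁ c₂ ih₁ ih₂ =>
    refine .seq ((ih₁ h).mono fun t₁ V₁ h₁ => (ih₂ h₁.2).mono fun t₂ V₂ h₂ => ⟨?_, h₂.2⟩)
    exact Nat.add_le_add h₁.1 h₂.1
  | ifLt a b c₁ c₂ ih₁ ih₂ =>
    simp only [Cmd.wp] at h
    refine .ifLt (fun hab => (ih₁ (by rwa [if_pos hab] at h)).mono fun t V' h' t' ht' => ?_)
      (fun hab => (ih₂ (by rwa [if_neg hab] at h)).mono fun t V' h' t' ht' => ?_)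
    all_goals exact ⟨by have := h'.1; simp only [Cmd.cost]; omega, h'.2⟩
  | ifEq a b c₁ c₂ ih₁ ih₂ =>
    simp only [Cmd.wp] at h
    refine .ifEq (fun hab => (ih₁ (by rwa [if_pos hab] at h)).mono fun t V' h' t' ht' => ?_)
      (fun hab => (ih₂ (by rwa [if_neg hab] at h)).mono fun t V' h' t' ht' => ?_)
    all_goals exact ⟨by have := h'.1; simp only [Cmd.cost]; omega, h'.2⟩
  | whileLt a b c ih => exact h.elim

end WordRAM

/-! ### Pairs of blocks: emptying and filling a block -/

namespace WordRAM

/-- The block with which block `b` shares its space: the first words of the two blocks point to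
each other and the barrier `μ` separates them. A block without such a partner is its own mate. -/
def mate (A : ℕ → ℕ) (N μ b : ℕ) : ℕ :=
  if A b < N ∧ A (A b) = b ∧ (b < μ ↔ μ ≤ A b) then A b else b

/-- The contents of the block `b` when the first and second words of the blocks are `A` and `B`. -/
def fstWord (A B : ℕ → ℕ) (N μ b : ℕ) : ℕ :=
  if b < μ then if mate A N μ b = b then A b else 0
  else if mate A N μ b = b then 0 else B (mate A N μ b)

/-- The second word of a nonempty block never leaves its place; only the first word can be displaced
by a pointer. -/
def sndWord (A B : ℕ → ℕ) (N μ b : ℕ) : ℕ :=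
  if b < μ then if mate A N μ b = b then B b else 0
  else if mate A N μ b = b then 0 else B b

/-- The blocks in front of the barrier `μ` that are their own mates and those behind it that are
not are exactly the nonempty blocks. -/
structure Valid (A B : ℕ → ℕ) (N μ : ℕ) : Prop where
  le : μ ≤ N
  ne_zero : ∀ b < N, (b < μ ↔ mate A N μ b = b) →
    ¬ (fstWord A B N μ b = 0 ∧ sndWord A B N μ b = 0)

/-- The conditions for a pair are symmetric in the two blocks. This involution makes the enumeration
meet each block once. -/
theorem mate_mate (A : ℕ → ℕ) {N μ b : ℕ} (hb : b < N) : mate A N μ (mate A N μ b) = b := by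
  grind [mate]

theorem mate_lt {A : ℕ → ℕ} {N μ b : ℕ} (hb : b < N) : mate A N μ b < N := by
  grind [mate]

/-- The trichotomy that lets the later case analyses replace `mate` by a plain variable; a block
that is its own mate is recorded as having no partner across the barrier. -/
theorem mate_cases (A : ℕ → ℕ) (N μ b : ℕ) :
    (mate A N μ b = b ∧ (A b < N → A (A b) = b → (b < μ ↔ A b < μ))) ∨
    (b < μ ∧ μ ≤ mate A N μ b ∧ mate A N μ b < N ∧ A b = mate A N μ b ∧ A (mate A N μ b) = b) ∨
    (μ ≤ b ∧ mate A N μ b < μ ∧ mate A N μ b < N ∧ A b = mate A N μ b ∧ A (mate A N μ b) = b) := by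
  grind [mate]

theorem mate_eq_self {A : ℕ → ℕ} {N μ b : ℕ} (h : A b < N → A (A b) = b → (b < μ ↔ A b < μ)) :
    mate A N μ b = b := by
  grind [mate]

theorem mate_eq_of {A : ℕ → ℕ} {N μ b c : ℕ} (hc : c < N) (h₁ : A b = c) (h₂ : A c = b)
    (h : b < μ ↔ μ ≤ c) : mate A N μ b = c := by
  grind [mate]

/-- The memory after emptying block `b`. -/
def removeA (A : ℕ → ℕ) (N μ b : ℕ) : ℕ → ℕ :=
  Function.update (Function.update A (mate A N μ b) (mate A N μ (μ - 1)))
    (mate A N μ (μ - 1)) (mate A N μ b)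

/-- When the barrier retreats past `μ - 1`, the nonempty block of that pair must be attached to the
place that `b` vacates in front of the barrier. Its second word stays put, so only its first word is
copied; that word lies in `A` or `B` of `μ - 1` according to whether `μ - 1` is its own mate. -/
def removeB (A B : ℕ → ℕ) (N μ b : ℕ) : ℕ → ℕ :=
  Function.update B (mate A N μ b)
    (if mate A N μ (μ - 1) = μ - 1 then A (μ - 1) else B (μ - 1))

theorem pos_of_ne_zero {A B : ℕ → ℕ} {N μ b : ℕ}
    (hne : ¬ (fstWord A B N μ b = 0 ∧ sndWord A B N μ b = 0)) : 0 < μ := by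
  grind [mate, fstWord, sndWord]

theorem iff_mate_of_ne_zero {A B : ℕ → ℕ} {N μ b : ℕ}
    (hne : ¬ (fstWord A B N μ b = 0 ∧ sndWord A B N μ b = 0)) : b < μ ↔ mate A N μ b = b := by
  grind [mate, fstWord, sndWord]

/-- Here `e` is the block passed by the barrier and `a`, `f`, `d` are the old mates of `b`, `e`,
`c`. If `a = e`, the pair simply dissolves; otherwise `a` and `f` become mates and their former
partners, if any, are left alone. The only new pointers join `a` and `f`, so no unintended pair can
arise. -/
theorem mate_remove_aux {A A' : ℕ → ℕ} {N e b a f c d : ℕ} (he : e < N) (hb : b < N) (hc : c < N)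
    (hA : A' = Function.update (Function.update A a f) f a)
    (hb' : (a = b ∧ b ≤ e ∧ (A b < N → A (A b) = b → (b < e + 1 ↔ A b < e + 1))) ∨
      (e < b ∧ a ≤ e ∧ A b = a ∧ A a = b))
    (he' : (f = e ∧ (A e < N → A (A e) = e → (e < e + 1 ↔ A e < e + 1))) ∨
      (e < f ∧ f < N ∧ A e = f ∧ A f = e))
    (hc' : (d = c ∧ (A c < N → A (A c) = c → (c < e + 1 ↔ A c < e + 1))) ∨
      (c ≤ e ∧ e < d ∧ d < N ∧ A c = d ∧ A d = c) ∨ (e < c ∧ d ≤ e ∧ A c = d ∧ A d = c)) :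
    mate A' N e c =
      if a = e then if c = b ∨ c = e then c else d
      else if c = a then f else if c = f then a else if c = b ∨ c = e then c else d := by
  have hA' : ∀ x, A' x = if x = f then a else if x = a then f else A x := by
    intro x; rw [hA]; simp only [Function.update_apply]
  clear hA
  by_cases hae : a = e
  · rw [if_pos hae]
    -- The mate of `b` is `e`, hence the mate of `e` is `b`.
    have hfb : f = b := by grind
    split_ifs with h
    · apply mate_eq_self; grind
    · rcases hc' with hc' | hc' | hc'
      · rw [hc'.1]; apply mate_eq_self; grind
      · apply mate_eq_of <;> grind
      · apply mate_eq_of <;> grind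
  · rw [if_neg hae]
    split_ifs with h₁ h₂ h₃
    · apply mate_eq_of <;> grind
    · apply mate_eq_of <;> grind
    · apply mate_eq_self; grind
    · rcases hc' with hc' | hc' | hc'
      · rw [hc'.1]; apply mate_eq_self; grind
      · apply mate_eq_of <;> grind
      · apply mate_eq_of <;> grind

theorem mate_remove {A : ℕ → ℕ} {N μ b c : ℕ} (hμ : 0 < μ) (hμN : μ ≤ N) (hb : b < N) (hc : c < N)
    (hne : b < μ ↔ mate A N μ b = b) :
    mate (removeA A N μ b) N (μ - 1) c =
      if mate A N μ b = μ - 1 then if c = b ∨ c = μ - 1 then c else mate A N μ c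
      else if c = mate A N μ b then mate A N μ (μ - 1)
      else if c = mate A N μ (μ - 1) then mate A N μ b
      else if c = b ∨ c = μ - 1 then c else mate A N μ c := by
  have hb' := mate_cases A N μ b
  have he' := mate_cases A N μ (μ - 1)
  have hc' := mate_cases A N μ c
  -- Writing the old barrier as a successor removes the truncated subtraction.
  obtain ⟨e, rfl⟩ : ∃ e, μ = e + 1 := ⟨μ - 1, by omega⟩
  apply mate_remove_aux (by omega) hb hc rfl <;> simp only [Nat.add_sub_cancel] at * <;> grind

theorem words_remove {A B : ℕ → ℕ} {N μ b c : ℕ} (h : Valid A B N μ) (hb : b < N) (hc : c < N)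
    (hne : ¬ (fstWord A B N μ b = 0 ∧ sndWord A B N μ b = 0)) :
    fstWord (removeA A N μ b) (removeB A B N μ b) N (μ - 1) c =
        (if c = b then 0 else fstWord A B N μ c) ∧
      sndWord (removeA A N μ b) (removeB A B N μ b) N (μ - 1) c =
        if c = b then 0 else sndWord A B N μ c := by
  have hμ := pos_of_ne_zero hne
  have hbm := iff_mate_of_ne_zero hne
  have hm := mate_remove hμ h.le hb hc hbm
  have hb' := mate_cases A N μ b
  have he' := mate_cases A N μ (μ - 1)
  have hc' := mate_cases A N μ c
  obtain ⟨e, rfl⟩ : ∃ e, μ = e + 1 := ⟨μ - 1, by omega⟩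
  unfold fstWord sndWord
  rw [hm]
  unfold removeA removeB
  simp only [Function.update_apply, Nat.add_sub_cancel] at *
  generalize mate A N (e + 1) b = a at *
  generalize mate A N (e + 1) e = f at *
  generalize mate A N (e + 1) c = d at *
  clear hm hne
  by_cases hae : a = e
  · constructor <;> grind
  · constructor <;> grind

theorem Valid.remove {A B : ℕ → ℕ} {N μ b : ℕ} (h : Valid A B N μ) (hb : b < N)
    (hne : ¬ (fstWord A B N μ b = 0 ∧ sndWord A B N μ b = 0)) :
    Valid (removeA A N μ b) (removeB A B N μ b) N (μ - 1) := by
  have hμ := pos_of_ne_zero hne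
  have hbm := iff_mate_of_ne_zero hne
  have hle := h.le
  refine ⟨by omega, fun c hc hcm => ?_⟩
  rw [(words_remove h hb hc hne).1, (words_remove h hb hc hne).2]
  -- A block in a nonempty position for the new barrier was in one for the old barrier, and it is
  -- not the block just emptied.
  have key : c ≠ b ∧ (c < μ ↔ mate A N μ c = c) := by
    rw [mate_remove hμ h.le hb hc hbm] at hcm
    have hb' := mate_cases A N μ b
    have he' := mate_cases A N μ (μ - 1)
    have hc' := mate_cases A N μ c
    obtain ⟨e, rfl⟩ : ∃ e, μ = e + 1 := ⟨μ - 1, by omega⟩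
    simp only [Nat.add_sub_cancel] at *
    generalize mate A N (e + 1) b = a at *
    generalize mate A N (e + 1) e = f at *
    generalize mate A N (e + 1) c = d at *
    by_cases hae : a = e
    · grind
    · grind
  rw [if_neg key.1, if_neg key.1]
  exact h.ne_zero c hc key.2

/-- Make the block `v` its own mate. -/
def unlink (A : ℕ → ℕ) (N μ v : ℕ) : ℕ → ℕ :=
  if mate A N μ v = v then A else Function.update A (mate A N μ v) (mate A N μ v)

/-- The only word that can change lies behind the barrier and points to `v`, and it becomes a
self-pointer. A self-pointer cannot belong to a pair, so no other pair is affected. -/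
theorem unlink_spec {A : ℕ → ℕ} {N μ v : ℕ} (hv : v < μ) :
    (∀ z, unlink A N μ v z = A z ∨ (unlink A N μ v z = z ∧ μ ≤ z ∧ A z = v)) ∧
    (unlink A N μ v v < N → unlink A N μ v (unlink A N μ v v) = v → unlink A N μ v v < μ) := by
  have h := mate_cases A N μ v
  unfold unlink
  generalize mate A N μ v = q at *
  split_ifs with hq
  · grind
  · simp only [Function.update_apply]
    grind

/-- The memory after storing the nonzero contents `x`, `y` in the empty block `b`, before possible
unintended pairs are removed. -/
def linkA (A B : ℕ → ℕ) (N μ b : ℕ) : ℕ → ℕ :=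
  let A' := if mate A N μ μ = μ then A else Function.update A μ (B (mate A N μ μ))
  if mate A N μ b = μ then A' else
    Function.update (Function.update A' (mate A N μ μ) (mate A N μ b))
      (mate A N μ b) (mate A N μ μ)

/-- The place freed at `mate μ` receives the displaced first word of the block attached to it: the
new word `x` if that block is `b` itself, and otherwise the word that was lodged in `b` for its
former mate. -/
def addB (A B : ℕ → ℕ) (N μ b x y : ℕ) : ℕ → ℕ :=
  Function.update (if mate A N μ b = μ then B else
    Function.update B (mate A N μ μ) (if mate A N μ b = b then x else B b)) b y

/-- Data is written as first word only in `b`, if it lies in front of the new barrier, and in `μ`,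
if its pair is broken up because both members are now in front. These are the two blocks that might
be paired by accident. -/
def addA (A B : ℕ → ℕ) (N μ b x : ℕ) : ℕ → ℕ :=
  let A' := if b < μ + 1 then unlink (Function.update (linkA A B N μ b) b x) N (μ + 1) b
    else linkA A B N μ b
  if mate A N μ μ = μ then A' else unlink A' N (μ + 1) μ

/-- All that the analysis of mates needs to know about the repairs: each first word is the intended
one or a self-pointer behind the barrier, and the blocks that received data have no partner. -/
theorem addA_spec (A B : ℕ → ℕ) (N e b x : ℕ) :
    (∀ z, addA A B N e b x z = (if z = b ∧ b ≤ e then x else linkA A B N e b z) ∨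
      (addA A B N e b x z = z ∧ e < z ∧
        (linkA A B N e b z = b ∧ b ≤ e ∨ linkA A B N e b z = e ∧ mate A N e e ≠ e))) ∧
    (b ≤ e → addA A B N e b x b < N → addA A B N e b x (addA A B N e b x b) = b →
      addA A B N e b x b ≤ e) ∧
    (mate A N e e ≠ e → addA A B N e b x e < N → addA A B N e b x (addA A B N e b x e) = e →
      addA A B N e b x e ≤ e) := by
  unfold addA
  generalize linkA A B N e b = L
  by_cases hb : b < e + 1
  · rw [if_pos hb]
    have h₁ := unlink_spec (A := Function.update L b x) (N := N) hb
    generalize unlink (Function.update L b x) N (e + 1) b = L₁ at *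
    simp only [Function.update_apply] at h₁
    split_ifs with he
    · grind (splits := 30)
    · have h₂ := unlink_spec (A := L₁) (N := N) (Nat.lt_succ_self e)
      generalize unlink L₁ N e.succ e = L₂ at *
      grind (splits := 30)
  · rw [if_neg hb]
    split_ifs with he
    · grind (splits := 30)
    · have h₂ := unlink_spec (A := L) (N := N) (Nat.lt_succ_self e)
      generalize unlink L N e.succ e = L₂ at *
      grind (splits := 30)

/-- Here `c`, `g`, `d` are the old mates of `b`, `e`, `z`, and `e` is the block that comes in front
of the barrier. The empty place `g` must be matched with `c`, which is `b` itself or the nonempty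
block that loses its partner `b`. If `c = e`, no new pair is needed. -/
theorem mate_add_aux {A A' L B : ℕ → ℕ} {N e b g c z d x : ℕ} (he : e < N) (hb : b < N) (hz : z < N)
    (hL : ∀ v, L v = if c = e then if g = e then A v else if v = e then B g else A v
      else if v = c then g else if v = g then c
      else if g = e then A v else if v = e then B g else A v)
    (hA₁ : ∀ z, A' z = (if z = b ∧ b ≤ e then x else L z) ∨
      (A' z = z ∧ e < z ∧ (L z = b ∧ b ≤ e ∨ L z = e ∧ g ≠ e)))
    (hA₂ : b ≤ e → A' b < N → A' (A' b) = b → A' b ≤ e)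
    (hA₃ : g ≠ e → A' e < N → A' (A' e) = e → A' e ≤ e)
    (hb' : (c = b ∧ e ≤ b ∧ (A b < N → A (A b) = b → e ≤ A b)) ∨
      (b < e ∧ e ≤ c ∧ c < N ∧ A b = c ∧ A c = b))
    (hg' : (g = e ∧ (A e < N → A (A e) = e → e ≤ A e)) ∨
      (g < e ∧ A e = g ∧ A g = e))
    (hz' : (d = z ∧ (A z < N → A (A z) = z → (z < e ↔ A z < e))) ∨
      (z < e ∧ e ≤ d ∧ d < N ∧ A z = d ∧ A d = z) ∨ (e ≤ z ∧ d < e ∧ A z = d ∧ A d = z)) :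
    mate A' N (e + 1) z =
      if c = e then if z = b ∨ z = e then z else d
      else if z = g then c else if z = c then g else if z = b ∨ z = e then z else d := by
  by_cases hce : c = e
  · rw [if_pos hce]
    have hgb : g = b := by grind (splits := 30)
    simp only [hce, if_true] at hL
    split_ifs with h
    · apply mate_eq_self; grind (splits := 30)
    · rcases hz' with hz' | hz' | hz'
      · rw [hz'.1]; apply mate_eq_self; grind (splits := 30)
      · apply mate_eq_of <;> grind (splits := 30)
      · apply mate_eq_of <;> grind (splits := 30)
  · rw [if_neg hce]
    simp only [hce, if_false] at hL
    split_ifs with h₁ h₂ h₃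
    · apply mate_eq_of <;> grind (splits := 30)
    · apply mate_eq_of <;> grind (splits := 30)
    · apply mate_eq_self; grind (splits := 30)
    · rcases hz' with hz' | hz' | hz'
      · rw [hz'.1]; apply mate_eq_self; grind (splits := 30)
      · apply mate_eq_of <;> grind (splits := 30)
      · apply mate_eq_of <;> grind (splits := 30)

theorem Valid.iff_mate_ne {A B : ℕ → ℕ} {N μ b : ℕ} (h : Valid A B N μ) (hb : b < N)
    (h₁ : fstWord A B N μ b = 0) (h₂ : sndWord A B N μ b = 0) : b < μ ↔ mate A N μ b ≠ b := by
  have := h.ne_zero b hb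
  tauto

/-- An empty block lies behind the barrier or has its mate there, so the barrier has room to
advance. -/
theorem Valid.lt_of_eq_zero {A B : ℕ → ℕ} {N μ b : ℕ} (h : Valid A B N μ) (hb : b < N)
    (h₁ : fstWord A B N μ b = 0) (h₂ : sndWord A B N μ b = 0) : μ < N := by
  have h₃ := h.iff_mate_ne hb h₁ h₂
  have h₄ := h.le
  have := mate_cases A N μ b
  by_contra
  omega

theorem linkA_apply (A B : ℕ → ℕ) (N μ b v : ℕ) :
    linkA A B N μ b v = if mate A N μ b = μ then if mate A N μ μ = μ then A v
      else if v = μ then B (mate A N μ μ) else A v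
      else if v = mate A N μ b then mate A N μ μ else if v = mate A N μ μ then mate A N μ b
      else if mate A N μ μ = μ then A v else if v = μ then B (mate A N μ μ) else A v := by
  unfold linkA
  simp only [apply_ite (fun f : ℕ → ℕ => f v), Function.update_apply]

theorem mate_add {A B : ℕ → ℕ} {N μ b c x : ℕ} (hμN : μ < N) (hb : b < N) (hc : c < N)
    (hne : b < μ ↔ mate A N μ b ≠ b) :
    mate (addA A B N μ b x) N (μ + 1) c =
      if mate A N μ b = μ then if c = b ∨ c = μ then c else mate A N μ c
      else if c = mate A N μ μ then mate A N μ b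
      else if c = mate A N μ b then mate A N μ μ
      else if c = b ∨ c = μ then c else mate A N μ c := by
  have hb' := mate_cases A N μ b
  have he' := mate_cases A N μ μ
  have hc' := mate_cases A N μ c
  obtain ⟨h₁, h₂, h₃⟩ := addA_spec A B N μ b x
  apply mate_add_aux hμN hb hc (L := linkA A B N μ b) (B := B) (x := x) (A := A) _ h₁ h₂ h₃
  · grind
  · grind
  · grind
  · exact linkA_apply A B N μ b

theorem words_add {A B : ℕ → ℕ} {N μ b c x y : ℕ} (h : Valid A B N μ) (hb : b < N) (hc : c < N)
    (h₁ : fstWord A B N μ b = 0) (h₂ : sndWord A B N μ b = 0) :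
    fstWord (addA A B N μ b x) (addB A B N μ b x y) N (μ + 1) c =
        (if c = b then x else fstWord A B N μ c) ∧
      sndWord (addA A B N μ b x) (addB A B N μ b x y) N (μ + 1) c =
        if c = b then y else sndWord A B N μ c := by
  have hne := h.iff_mate_ne hb h₁ h₂
  have hμ := h.lt_of_eq_zero hb h₁ h₂
  have hm := mate_add (B := B) (x := x) hμ hb hc hne
  have hb' := mate_cases A N μ b
  have he' := mate_cases A N μ μ
  have hc' := mate_cases A N μ c
  have hA := (addA_spec A B N μ b x).1 c
  have hL := linkA_apply A B N μ b c
  clear h₁ h₂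
  unfold fstWord sndWord
  rw [hm]
  generalize addA A B N μ b x c = A' at *
  generalize linkA A B N μ b c = L at *
  unfold addB
  simp only [Function.update_apply] at *
  generalize mate A N μ b = a at *
  generalize mate A N μ μ = g at *
  generalize mate A N μ c = d at *
  clear hm
  by_cases hae : a = μ
  · constructor <;> grind (splits := 30)
  · constructor <;> grind (splits := 30)

theorem Valid.add {A B : ℕ → ℕ} {N μ b x y : ℕ} (h : Valid A B N μ) (hb : b < N)
    (h₁ : fstWord A B N μ b = 0) (h₂ : sndWord A B N μ b = 0) (hxy : ¬ (x = 0 ∧ y = 0)) :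
    Valid (addA A B N μ b x) (addB A B N μ b x y) N (μ + 1) := by
  have hne := h.iff_mate_ne hb h₁ h₂
  have hμ := h.lt_of_eq_zero hb h₁ h₂
  refine ⟨by omega, fun c hc hcm => ?_⟩
  rw [(words_add h hb hc h₁ h₂).1, (words_add h hb hc h₁ h₂).2]
  by_cases hcb : c = b
  · simpa [hcb] using hxy
  rw [if_neg hcb, if_neg hcb]
  refine h.ne_zero c hc ?_
  rw [mate_add hμ hb hc hne] at hcm
  have hb' := mate_cases A N μ b
  have he' := mate_cases A N μ μ
  have hc' := mate_cases A N μ c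
  generalize mate A N μ b = a at *
  generalize mate A N μ μ = g at *
  generalize mate A N μ c = d at *
  clear h₁ h₂
  by_cases hae : a = μ
  · grind (splits := 30)
  · grind (splits := 30)

/-! ### The index of the lowest set bit -/

/-- A word in which the numbers below `s` are stored in fields of doubling width. -/
theorem exists_log_table (s : ℕ) :
    ∃ L < 2 ^ 2 ^ s, ∀ b < s, L / 2 ^ 2 ^ b % 2 ^ 2 ^ b = b := by
  induction s with
  | zero => exact ⟨0, by simp⟩
  | succ s ih =>
    obtain ⟨L, hL, h⟩ := ih
    have hs : s < 2 ^ 2 ^ s := Nat.lt_two_pow_self.trans Nat.lt_two_pow_self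
    -- The new field starts at bit `2 ^ s`, just above all earlier ones, and has room for `2 ^ s`
    -- bits.
    refine ⟨L + 2 ^ 2 ^ s * s, ?_, fun b hb => ?_⟩
    · rw [pow_succ 2 s, pow_mul, sq]
      nlinarith
    · rcases Nat.lt_succ_iff_lt_or_eq.1 hb with hb | rfl
      -- The field of `b < s` ends at bit `2 ^ b + 2 ^ b ≤ 2 ^ s`, so the added term vanishes in the
      -- extraction.
      · obtain ⟨k, hk⟩ : ∃ k, 2 ^ 2 ^ s = 2 ^ 2 ^ b * (2 ^ 2 ^ b * k) := by
          have : 2 ^ b + 2 ^ b ≤ 2 ^ s := by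
            calc 2 ^ b + 2 ^ b = 2 ^ (b + 1) := by ring
              _ ≤ 2 ^ s := Nat.pow_le_pow_right two_pos hb
          refine ⟨2 ^ (2 ^ s - (2 ^ b + 2 ^ b)), ?_⟩
          rw [← pow_add, ← pow_add]
          congr 1; omega
        rw [hk, mul_assoc, Nat.add_mul_div_left _ _ (by positivity), mul_assoc,
          Nat.add_mul_mod_self_left, h b hb]
      · rw [Nat.add_mul_div_left _ _ (by positivity), Nat.div_eq_of_lt hL, zero_add,
          Nat.mod_eq_of_lt hs]

/-- Since `2 ^ s ≡ 1` modulo `2 ^ s - 1`, the exponent matters only modulo `s`. For `s ≥ 2` the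
reduced power is already smaller than the modulus. -/
theorem pow_mod_pred (s j : ℕ) (hs : 2 ≤ s) : 2 ^ j % (2 ^ s - 1) = 2 ^ (j % s) := by
  have h4 : 4 ≤ 2 ^ s := by
    calc 4 = 2 ^ 2 := rfl
      _ ≤ 2 ^ s := Nat.pow_le_pow_right two_pos hs
  have h1 : 2 ^ s ≡ 1 [MOD 2 ^ s - 1] := by
    apply Nat.ModEq.symm
    rw [Nat.modEq_iff_dvd' (by omega)]
  have h2 : 2 ^ j ≡ 2 ^ (j % s) [MOD 2 ^ s - 1] := by
    conv_lhs => rw [← Nat.div_add_mod j s, pow_add, pow_mul]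
    simpa using (h1.pow (j / s)).mul_right (2 ^ (j % s))
  rw [h2, Nat.mod_eq_of_lt]
  have : 2 ^ (j % s) ≤ 2 ^ (s - 1) :=
    Nat.pow_le_pow_right two_pos (by have := Nat.mod_lt j (show 0 < s by omega); omega)
  have : 2 ^ s = 2 ^ (s - 1) * 2 := by rw [← pow_succ]; congr 1; omega
  omega

/-- The quotient is the geometric sum of `a` powers of `M + 1`, each congruent to `1` modulo `M`. -/
theorem geom_div_mod (M a : ℕ) (hM : 0 < M) (ha : a < M) : ((M + 1) ^ a - 1) / M % M = a := by
  obtain ⟨k, hk⟩ : ∃ k, (M + 1) ^ a = 1 + M * (a + M * k) := by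
    clear ha
    induction a with
    | zero => exact ⟨0, by simp⟩
    | succ a ih =>
      obtain ⟨k, hk⟩ := ih
      exact ⟨k + a + M * k, by rw [pow_succ, hk]; ring⟩
  rw [hk, Nat.add_sub_cancel_left, Nat.mul_div_cancel_left _ hM, Nat.add_mul_mod_self_left,
    Nat.mod_eq_of_lt ha]

/-- The exponent of a power of two is found with a constant number of word operations. -/
theorem log_formula {w s L j : ℕ} (hs : 4 ≤ s) (hw : w < 2 ^ (s + 1))
    (hL : ∀ b < s, L / 2 ^ 2 ^ b % 2 ^ 2 ^ b = b) (hj : j < w) :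
    (2 ^ j / (2 ^ j % (2 ^ s - 1)) - 1) / (2 ^ s - 1) % (2 ^ s - 1) * s +
      L / 2 ^ (2 ^ j % (2 ^ s - 1)) % 2 ^ (2 ^ j % (2 ^ s - 1)) = j := by
  rw [pow_mod_pred s j (by omega), hL _ (Nat.mod_lt _ (by omega)),
    Nat.pow_div (Nat.mod_le _ _) two_pos]
  have h1 : 1 ≤ 2 ^ s := Nat.one_le_two_pow
  have h2 : j - j % s = s * (j / s) := by
    rw [Nat.sub_eq_iff_eq_add (Nat.mod_le _ _), Nat.div_add_mod]
  -- With `s ≥ 4` the quotient is below `2 ^ (s + 1) / 4`, small enough to be recovered modulo `2 ^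
  -- s - 1`.
  have h3 : j / s < 2 ^ s - 1 := by
    have : j / s ≤ j / 4 := Nat.div_le_div_left hs (by omega)
    have : 2 ^ 4 ≤ 2 ^ s := Nat.pow_le_pow_right two_pos hs
    rw [pow_succ] at hw
    omega
  have h4 := geom_div_mod (2 ^ s - 1) (j / s) (Nat.zero_lt_of_lt h3) h3
  rw [Nat.sub_add_cancel h1] at h4
  rw [h2, pow_mul, h4]
  have := Nat.div_add_mod j s
  rw [mul_comm]; exact this

/-- Write `x = 2 ^ j * (2 * q + 1)`. Subtracting `1` flips exactly the bits up to `j`, and of these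
only bit `j` is set in `x`. -/
theorem lowest_bit {x : ℕ} (hx : x ≠ 0) :
    ∃ j, x.testBit j = true ∧ x &&& (x ^^^ (x - 1)) = 2 ^ j ∧ 2 ^ j ≤ x ∧
      ∀ i, (x - 2 ^ j).testBit i = true ↔ x.testBit i = true ∧ i ≠ j := by
  obtain ⟨j, k, ⟨q, rfl⟩, rfl⟩ := Nat.exists_eq_two_pow_mul_odd hx
  have hp : 2 ^ j < 2 ^ (j + 1) := Nat.pow_lt_pow_right (by norm_num) (by omega)
  have hp0 : 0 < 2 ^ j := by positivity
  have e₁ : 2 ^ j * (2 * q + 1) = 2 ^ (j + 1) * q + 2 ^ j := by ring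
  have e₂ : 2 ^ (j + 1) * q + 2 ^ j - 1 = 2 ^ (j + 1) * q + (2 ^ j - 1) := by omega
  have e₃ : 2 ^ (j + 1) * q + 2 ^ j - 2 ^ j = 2 ^ (j + 1) * q + 0 := by omega
  refine ⟨j, ?_⟩
  rw [e₁, e₂, e₃]
  refine ⟨?_, Nat.eq_of_testBit_eq fun i => ?_, by omega, fun i => ?_⟩
  · simp [Nat.testBit_two_pow_mul_add _ hp]
  · rw [Nat.testBit_and, Nat.testBit_xor, Nat.testBit_two_pow_mul_add _ hp,
      Nat.testBit_two_pow_mul_add _ (show 2 ^ j - 1 < 2 ^ (j + 1) by omega)]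
    simp only [Nat.testBit_two_pow, Nat.testBit_two_pow_sub_one]
    by_cases h : i < j + 1 <;> by_cases h' : j = i <;> simp [h, h']
  · rw [Nat.testBit_two_pow_mul_add _ hp,
      Nat.testBit_two_pow_mul_add _ (show 0 < 2 ^ (j + 1) by omega)]
    simp only [Nat.testBit_two_pow, Nat.zero_testBit]
    by_cases h : i < j + 1 <;> by_cases h' : j = i <;> simp [h, h']
    omega

/-! ### Register layout and block operations as programs -/

/-- The registers `1, …, 8` hold the constants used, the number `N` of blocks and the barrier `μ`,
and the memory holds the first words `A` and then the second words `B` of the blocks. -/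
structure Stores (w L N : ℕ) (V : NatState 31) (A B : ℕ → ℕ) (μ : ℕ) : Prop where
  zero : V.reg 1 = 0
  one : V.reg 2 = 1
  width : V.reg 3 = w
  ones : V.reg 4 = 2 ^ Nat.log 2 w - 1
  log : V.reg 5 = Nat.log 2 w
  table : V.reg 6 = L
  size : V.reg 7 = N
  barrier : V.reg 8 = μ
  fst : ∀ b < N, V.mem b = A b
  snd : ∀ b < N, V.mem (N + b) = B b

namespace Stores

variable {w L N μ b : ℕ} {V : NatState 31} {A B : ℕ → ℕ}

theorem setReg (h : Stores w L N V A B μ) (d : Fin 32) (v : ℕ) (hd : d = 0 ∨ 8 < d) :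
    Stores w L N (V.setReg d v) A B μ := by
  constructor <;> simp only [NatState.reg_setReg, NatState.mem_setReg]
  case fst => exact h.fst
  case snd => exact h.snd
  all_goals rw [if_neg (by rintro rfl; revert hd; decide)]
  exacts [h.zero, h.one, h.width, h.ones, h.log, h.table, h.size, h.barrier]

theorem setBarrier (h : Stores w L N V A B μ) (v : ℕ) : Stores w L N (V.setReg 8 v) A B v := by
  constructor <;> simp [h.zero, h.one, h.width, h.ones, h.log, h.table, h.size]
  exacts [h.fst, h.snd]

theorem setFst (h : Stores w L N V A B μ) (hb : b < N) (v : ℕ) :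
    Stores w L N (V.setMem b v) (Function.update A b v) B μ where
  __ := h
  fst c hc := by simp [Function.update_apply, h.fst c hc]
  snd c hc := by
    rw [← h.snd c hc]
    simp [Function.update_apply]
    omega

theorem setSnd (h : Stores w L N V A B μ) (b v : ℕ) :
    Stores w L N (V.setMem (N + b) v) A (Function.update B b v) μ where
  __ := h
  fst c hc := by
    rw [← h.fst c hc]
    simp [Function.update_apply]
    omega
  snd c hc := by simp [Function.update_apply, h.snd c hc]

theorem write (h : Stores w L N V A B μ) (v : ℕ) : Stores w L N (V.write v) A B μ where
  __ := h

end Stores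

theorem Cmd.wp_seq {w m : ℕ} {κ : Fin 6 → BitVec w} (c₁ c₂) (Q : NatState 31 → Prop) (V) :
    (c₁ ;; c₂).wp κ m Q V = c₁.wp κ m (c₂.wp κ m Q) V := rfl

theorem Cmd.wp_emit {w m : ℕ} {κ : Fin 6 → BitVec w} (a) (Q : NatState 31 → Prop) (V) :
    (Cmd.emit a).wp κ m Q V = Q (V.write (V.reg a)) := rfl

theorem Cmd.wp_ifLt {w m : ℕ} {κ : Fin 6 → BitVec w} (a b c₁ c₂)
    (Q : NatState 31 → Prop) (V) : (Cmd.ifLt a b c₁ c₂).wp κ m Q V =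
      if V.reg a < V.reg b then c₁.wp κ m Q V else c₂.wp κ m Q V := rfl

theorem Cmd.wp_ifEq {w m : ℕ} {κ : Fin 6 → BitVec w} (a b c₁ c₂)
    (Q : NatState 31 → Prop) (V) : (Cmd.ifEq a b c₁ c₂).wp κ m Q V =
      if V.reg a = V.reg b then c₁.wp κ m Q V else c₂.wp κ m Q V := rfl

/-- Read the second word of block `b`. -/
def loadSnd (d b : Fin 32) : Cmd 31 6 := .op .add 20 b 7 ;; .load d 20

/-- Write the second word of block `b`. -/
def storeSnd (b x : Fin 32) : Cmd 31 6 := .op .add 20 b 7 ;; .store 20 x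

def move (d b : Fin 32) : Cmd 31 6 := .op .or d b b

/-- Compute the mate of block `b`. -/
def mateCmd (d b : Fin 32) : Cmd 31 6 :=
  move d b ;; .load 30 b ;;
  .ifLt 30 7
    (.load 31 30 ;;
    .ifEq 31 b
      (.ifLt b 8 (.ifLt 30 8 .skip (move d 30)) (.ifLt 30 8 (move d 30) .skip))
      .skip)
    .skip

/-- `V'` arises from `V` by changing only registers in the list `l`. -/
structure Frame (l : List (Fin 32)) (V V' : NatState 31) : Prop where
  reg : ∀ d, d ∉ l → V'.reg d = V.reg d
  out : V'.out = V.out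

theorem Frame.refl (l : List (Fin 32)) (V : NatState 31) : Frame l V V := ⟨fun _ _ => rfl, rfl⟩

theorem Frame.mono {l l' : List (Fin 32)} {V V' : NatState 31} (h : Frame l V V')
    (hl : ∀ d ∈ l, d ∈ l') : Frame l' V V' :=
  ⟨fun d hd => h.reg d fun hd' => hd (hl d hd'), h.out⟩

theorem Frame.trans {l l' : List (Fin 32)} {V V' V'' : NatState 31} (h : Frame l V V')
    (h' : Frame l' V' V'') : Frame (l ++ l') V V'' := by
  refine ⟨fun d hd => ?_, h'.out.trans h.out⟩
  rw [List.mem_append, not_or] at hd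
  exact (h'.reg d hd.2).trans (h.reg d hd.1)

section

variable {w L N μ : ℕ} {V : NatState 31} {A B : ℕ → ℕ} {κ : Fin 6 → BitVec w}
  {Q : NatState 31 → Prop} {d b x : Fin 32}

theorem wp_loadFst (h : Stores w L N V A B μ) (hb : V.reg b < N)
    (hd : d = 0 ∨ 8 < d)
    (hQ : ∀ V', Stores w L N V' A B μ → V'.reg d = A (V.reg b) → Frame [d] V V' → Q V') :
    (Cmd.load d b).wp κ (2 * N) Q V := by
  refine ⟨by omega, hQ _ (h.setReg _ _ hd) (by simp [h.fst _ hb]) ⟨fun e he => ?_, rfl⟩⟩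
  simp_all

theorem wp_loadSnd (h : Stores w L N V A B μ) (hN : 2 * N ≤ 2 ^ w) (hb : V.reg b < N)
    (hd : d = 0 ∨ 8 < d)
    (hQ : ∀ V', Stores w L N V' A B μ → V'.reg d = B (V.reg b) → Frame [d, 20] V V' → Q V') :
    (loadSnd d b).wp κ (2 * N) Q V := by
  have e : BinOp.natEval w .add (V.reg b) (V.reg 7) = N + V.reg b := by
    rw [h.size, BinOp.natEval, Nat.mod_eq_of_lt (by omega), Nat.add_comm]
  simp only [loadSnd, Cmd.wp, e, NatState.reg_setReg, if_true]
  refine ⟨by omega, hQ _ ((h.setReg 20 _ (by decide)).setReg _ _ hd)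
    (by simp [h.snd _ hb]) ⟨fun e he => ?_, rfl⟩⟩
  simp_all

theorem wp_storeFst (h : Stores w L N V A B μ) (hb : V.reg b < N)
    (hQ : ∀ V', Stores w L N V' (Function.update A (V.reg b) (V.reg x)) B μ →
      Frame [] V V' → Q V') :
    (Cmd.store b x).wp κ (2 * N) Q V :=
  ⟨by omega, hQ _ (h.setFst hb _) ⟨fun e he => rfl, rfl⟩⟩

theorem wp_storeSnd (h : Stores w L N V A B μ) (hN : 2 * N ≤ 2 ^ w) (hb : V.reg b < N)
    (hx : x ≠ 20)
    (hQ : ∀ V', Stores w L N V' A (Function.update B (V.reg b) (V.reg x)) μ →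
      Frame [20] V V' → Q V') :
    (storeSnd b x).wp κ (2 * N) Q V := by
  have e : BinOp.natEval w .add (V.reg b) (V.reg 7) = N + V.reg b := by
    rw [h.size, BinOp.natEval, Nat.mod_eq_of_lt (by omega), Nat.add_comm]
  simp only [storeSnd, Cmd.wp, e, NatState.reg_setReg, if_true, if_neg hx]
  refine ⟨by omega, hQ _ ((h.setReg 20 _ (by decide)).setSnd _ _) ⟨fun e he => ?_, rfl⟩⟩
  simp_all

theorem wp_move (h : Stores w L N V A B μ) (hd : d = 0 ∨ 8 < d) {m : ℕ}
    (hQ : ∀ V', Stores w L N V' A B μ → V'.reg d = V.reg b → Frame [d] V V' → Q V') :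
    (move d b).wp κ m Q V := by
  refine hQ _ (h.setReg d _ hd) (by simp [BinOp.natEval]) ⟨fun e he => ?_, rfl⟩
  simp_all

theorem wp_mateCmd (h : Stores w L N V A B μ) (hb : V.reg b < N) (hd : d = 0 ∨ 8 < d)
    (hdb : d ∉ [b, 30, 31]) (hb' : b ∉ [30, 31])
    (hQ : ∀ V', Stores w L N V' A B μ → V'.reg d = mate A N μ (V.reg b) →
      Frame [d, 30, 31] V V' → Q V') :
    (mateCmd d b).wp κ (2 * N) Q V := by
  simp only [List.mem_cons, List.not_mem_nil, or_false, not_or] at hdb hb'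
  obtain ⟨hdb, hd₀, hd₁⟩ := hdb
  have h7 : (7 : Fin 32) ≠ d := by rintro rfl; revert hd; decide
  have h8 : (8 : Fin 32) ≠ d := by rintro rfl; revert hd; decide
  rw [mateCmd, Cmd.wp_seq]
  refine wp_move h hd fun V₁ h₁ r₁ f₁ => ?_
  have b₁ : V₁.reg b = V.reg b := f₁.reg b (by simp [Ne.symm hdb])
  rw [Cmd.wp_seq]
  refine wp_loadFst (κ := κ) h₁ (by omega) (by decide) fun V₂ h₂ r₂ f₂ => ?_
  rw [b₁] at r₂
  have d₂ : V₂.reg d = V.reg b := (f₂.reg d (by simp [hd₀])).trans r₁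
  have g₂ : Frame [d, 30, 31] V V₂ := (f₁.trans f₂).mono (by simp)
  rw [Cmd.wp_ifLt, h₂.size, r₂]
  split_ifs with c₁
  · rw [Cmd.wp_seq]
    refine wp_loadFst (κ := κ) h₂ (by omega) (by decide) fun V₃ h₃ r₃ f₃ => ?_
    rw [r₂] at r₃
    have b₃ : V₃.reg b = V.reg b :=
      (f₃.reg b (by simp [hb'])).trans ((f₂.reg b (by simp [hb'])).trans b₁)
    have d₃ : V₃.reg d = V.reg b := (f₃.reg d (by simp [hd₁])).trans d₂
    have e₃ : V₃.reg 30 = A (V.reg b) := (f₃.reg 30 (by decide)).trans r₂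
    have g₃ : Frame [d, 30, 31] V V₃ := (g₂.trans f₃).mono (by simp)
    rw [Cmd.wp_ifEq, Cmd.wp_ifLt, Cmd.wp_ifLt, Cmd.wp_ifLt, r₃, b₃, e₃, h₃.barrier]
    split_ifs with c₂ c₃ c₄ c₄
    · refine hQ _ h₃ ?_ g₃
      rw [d₃, mate, if_neg (by omega)]
    · refine wp_move h₃ hd fun V₄ h₄ r₄ f₄ => hQ _ h₄ ?_ ((g₃.trans f₄).mono (by simp))
      rw [r₄, e₃, mate, if_pos (by omega)]
    · refine wp_move h₃ hd fun V₄ h₄ r₄ f₄ => hQ _ h₄ ?_ ((g₃.trans f₄).mono (by simp))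
      rw [r₄, e₃, mate, if_pos (by omega)]
    · refine hQ _ h₃ ?_ g₃
      rw [d₃, mate, if_neg (by omega)]
    · refine hQ _ h₃ ?_ g₃
      rw [d₃, mate, if_neg (by omega)]
  · refine hQ _ h₂ ?_ g₂
    rw [d₂, mate, if_neg (by omega)]

end

theorem Cmd.wp_mono {w m R K : ℕ} {κ : Fin K → BitVec w} {c : Cmd R K} {V : NatState R}
    {Q Q' : NatState R → Prop} (h : c.wp κ m Q V) (hQ : ∀ V', Q V' → Q' V') : c.wp κ m Q' V := by
  induction c generalizing V Q Q' with
  | seq c₁ c₂ ih₁ ih₂ => exact ih₁ h fun V₁ h₁ => ih₂ h₁ hQ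
  | ifLt a b c₁ c₂ ih₁ ih₂ | ifEq a b c₁ c₂ ih₁ ih₂ =>
    simp only [Cmd.wp] at h ⊢
    split_ifs at h ⊢
    exacts [ih₁ h hQ, ih₂ h hQ]
  | load | store => exact ⟨h.1, hQ _ h.2⟩
  | whileLt => exact h
  | _ => exact hQ _ h

/-- Read the first word of the nonempty one of the block `e` before the barrier and its mate `p`. -/
def loadFstOf (d e p : Fin 32) : Cmd 31 6 := .ifEq p e (.load d e) (loadSnd d e)

/-- Read the contents of block `10` into the registers `11`, `12`. -/
def readCmd : Cmd 31 6 :=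
  mateCmd 13 10 ;;
  .ifLt 10 8
    (.ifEq 13 10 (.load 11 10 ;; loadSnd 12 10) (move 11 1 ;; move 12 1))
    (.ifEq 13 10 (move 11 1 ;; move 12 1) (loadSnd 11 13 ;; loadSnd 12 10))

/-- Find the nonempty one of the block `24` before the barrier and its mate, and its contents. -/
def pickCmd : Cmd 31 6 := mateCmd 13 24 ;; loadFstOf 11 24 13 ;; loadSnd 12 13

/-- Make the nonempty block `10` empty. -/
def removeCmd : Cmd 31 6 :=
  mateCmd 13 10 ;; .op .sub 15 8 2 ;; mateCmd 16 15 ;; loadFstOf 17 15 16 ;;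
  storeSnd 13 17 ;; .store 13 16 ;; .store 16 13 ;; .op .sub 8 8 2

def unlinkCmd (v : Fin 32) : Cmd 31 6 := mateCmd 19 v ;; .ifEq 19 v .skip (.store 19 19)

/-- Store the contents `11`, `12` in the empty block `10`. -/
def addCmd : Cmd 31 6 :=
  mateCmd 16 8 ;; mateCmd 13 10 ;; move 15 8 ;;
  .ifEq 13 10 (move 17 11) (loadSnd 17 10) ;;
  .ifEq 16 15 .skip (loadSnd 18 16 ;; .store 15 18) ;;
  .ifEq 13 15 .skip (storeSnd 16 17 ;; .store 16 13 ;; .store 13 16) ;;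
  .op .add 8 8 2 ;;
  storeSnd 10 12 ;;
  .ifLt 10 8 (.store 10 11 ;; unlinkCmd 10) .skip ;;
  .ifEq 16 15 .skip (unlinkCmd 15)

section

variable {w L N μ : ℕ} {V : NatState 31} {A B : ℕ → ℕ} {κ : Fin 6 → BitVec w}
  {Q : NatState 31 → Prop} {d b x : Fin 32}

theorem wp_op {f : BinOp} {a b : Fin 32} {v m : ℕ} (h : Stores w L N V A B μ) (hd : d = 0 ∨ 8 < d)
    (hv : f.natEval w (V.reg a) (V.reg b) = v)
    (hQ : ∀ V', Stores w L N V' A B μ → V'.reg d = v → Frame [d] V V' → Q V') :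
    (Cmd.op f d a b).wp κ m Q V := by
  subst hv
  refine hQ _ (h.setReg d _ hd) (by simp) ⟨fun e he => ?_, rfl⟩
  simp_all

theorem wp_op_barrier {f : BinOp} {a b : Fin 32} {v m : ℕ} (h : Stores w L N V A B μ)
    (hv : f.natEval w (V.reg a) (V.reg b) = v)
    (hQ : ∀ V', Stores w L N V' A B v → Frame [8] V V' → Q V') :
    (Cmd.op f 8 a b).wp κ m Q V := by
  subst hv
  refine hQ _ (h.setBarrier _) ⟨fun e he => ?_, rfl⟩
  simp_all

/-- Both branches meet in one assertion `Q'`, so the code that follows is verified once instead of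
once per branch. -/
theorem wp_ifEq_join {a b : Fin 32} {m : ℕ} {c₁ c₂ : Cmd 31 6} (Q' : NatState 31 → Prop)
    (h₁ : V.reg a = V.reg b → c₁.wp κ m Q' V) (h₂ : V.reg a ≠ V.reg b → c₂.wp κ m Q' V)
    (hQ : ∀ V', Q' V' → Q V') : (Cmd.ifEq a b c₁ c₂).wp κ m Q V := by
  rw [Cmd.wp_ifEq]
  split_ifs with h
  exacts [Cmd.wp_mono (h₁ h) hQ, Cmd.wp_mono (h₂ h) hQ]

theorem wp_ifLt_join {a b : Fin 32} {m : ℕ} {c₁ c₂ : Cmd 31 6} (Q' : NatState 31 → Prop)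
    (h₁ : V.reg a < V.reg b → c₁.wp κ m Q' V) (h₂ : ¬ V.reg a < V.reg b → c₂.wp κ m Q' V)
    (hQ : ∀ V', Q' V' → Q V') : (Cmd.ifLt a b c₁ c₂).wp κ m Q V := by
  rw [Cmd.wp_ifLt]
  split_ifs with h
  exacts [Cmd.wp_mono (h₁ h) hQ, Cmd.wp_mono (h₂ h) hQ]

theorem natEval_sub {x y : ℕ} (hx : x < 2 ^ w) (hy : y ≤ x) :
    BinOp.natEval w .sub x y = x - y := by
  have : 2 ^ w - y + x = 2 ^ w + (x - y) := by omega
  rw [BinOp.natEval, this, Nat.add_mod_left, Nat.mod_eq_of_lt (by omega)]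

theorem wp_loadFstOf {e p : Fin 32} (h : Stores w L N V A B μ) (hN : 2 * N ≤ 2 ^ w)
    (he : V.reg e < N) (hd : d = 0 ∨ 8 < d)
    (hQ : ∀ V', Stores w L N V' A B μ →
      V'.reg d = (if V.reg p = V.reg e then A (V.reg e) else B (V.reg e)) →
      Frame [d, 20] V V' → Q V') :
    (loadFstOf d e p).wp κ (2 * N) Q V := by
  rw [loadFstOf, Cmd.wp_ifEq]
  split_ifs with c
  · refine wp_loadFst h he hd fun V' h' r f => hQ V' h' ?_ (f.mono (by simp))
    rw [r, if_pos c]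
  · refine wp_loadSnd h hN he hd fun V' h' r f => hQ V' h' ?_ f
    rw [r, if_neg c]

theorem wp_readCmd (h : Stores w L N V A B μ) (hN : 2 * N ≤ 2 ^ w) (hb : V.reg 10 < N)
    (hQ : ∀ V', Stores w L N V' A B μ → V'.reg 11 = fstWord A B N μ (V.reg 10) →
      V'.reg 12 = sndWord A B N μ (V.reg 10) → Frame [11, 12, 13, 20, 30, 31] V V' → Q V') :
    readCmd.wp κ (2 * N) Q V := by
  rw [readCmd, Cmd.wp_seq]
  refine wp_mateCmd h hb (by decide) (by decide) (by decide) fun V₁ h₁ r₁ f₁ => ?_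
  have b₁ := f₁.reg 10 (by decide)
  have hm : V₁.reg 13 < N := r₁ ▸ mate_lt hb
  rw [Cmd.wp_ifLt, Cmd.wp_ifEq, Cmd.wp_ifEq, r₁, b₁, h₁.barrier]
  split_ifs with c₁ c₂ c₂
  · rw [Cmd.wp_seq]
    refine wp_loadFst (κ := κ) h₁ (b₁ ▸ hb) (by decide) fun V₂ h₂ r₂ f₂ => ?_
    have b₂ := (f₂.reg 10 (by decide)).trans b₁
    refine wp_loadSnd (κ := κ) h₂ hN (b₂ ▸ hb) (by decide) fun V₃ h₃ r₃ f₃ => ?_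
    have e₃ := f₃.reg 11 (by decide)
    refine hQ V₃ h₃ ?_ ?_ (((f₁.trans f₂).trans f₃).mono (by decide))
    · rw [e₃, r₂, b₁, fstWord, if_pos c₁, if_pos c₂]
    · rw [r₃, b₂, sndWord, if_pos c₁, if_pos c₂]
  · rw [Cmd.wp_seq]
    refine wp_move h₁ (by decide) fun V₂ h₂ r₂ f₂ => wp_move h₂ (by decide) fun V₃ h₃ r₃ f₃ => ?_
    have e₃ := f₃.reg 11 (by decide)
    refine hQ V₃ h₃ ?_ ?_ (((f₁.trans f₂).trans f₃).mono (by decide))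
    · rw [e₃, r₂, h₁.zero, fstWord, if_pos c₁, if_neg c₂]
    · rw [r₃, h₂.zero, sndWord, if_pos c₁, if_neg c₂]
  · rw [Cmd.wp_seq]
    refine wp_move h₁ (by decide) fun V₂ h₂ r₂ f₂ => wp_move h₂ (by decide) fun V₃ h₃ r₃ f₃ => ?_
    have e₃ := f₃.reg 11 (by decide)
    refine hQ V₃ h₃ ?_ ?_ (((f₁.trans f₂).trans f₃).mono (by decide))
    · rw [e₃, r₂, h₁.zero, fstWord, if_neg c₁, if_pos c₂]
    · rw [r₃, h₂.zero, sndWord, if_neg c₁, if_pos c₂]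
  · rw [Cmd.wp_seq]
    refine wp_loadSnd (κ := κ) h₁ hN hm (by decide) fun V₂ h₂ r₂ f₂ => ?_
    have b₂ := (f₂.reg 10 (by decide)).trans b₁
    refine wp_loadSnd (κ := κ) h₂ hN (b₂ ▸ hb) (by decide) fun V₃ h₃ r₃ f₃ => ?_
    have e₃ := f₃.reg 11 (by decide)
    refine hQ V₃ h₃ ?_ ?_ (((f₁.trans f₂).trans f₃).mono (by decide))
    · rw [e₃, r₂, r₁, fstWord, if_neg c₁, if_neg c₂]
    · rw [r₃, b₂, sndWord, if_neg c₁, if_neg c₂]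

theorem wp_pickCmd (h : Stores w L N V A B μ) (hN : 2 * N ≤ 2 ^ w) (hμN : μ ≤ N)
    (hb : V.reg 24 < μ)
    (hQ : ∀ V', Stores w L N V' A B μ → V'.reg 13 = mate A N μ (V.reg 24) →
      V'.reg 11 = fstWord A B N μ (mate A N μ (V.reg 24)) →
      V'.reg 12 = sndWord A B N μ (mate A N μ (V.reg 24)) →
      Frame [11, 12, 13, 20, 30, 31] V V' → Q V') :
    pickCmd.wp κ (2 * N) Q V := by
  have hb' : V.reg 24 < N := by omega
  have hmm := mate_mate A (μ := μ) hb'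
  have hmc := mate_cases A N μ (V.reg 24)
  unfold pickCmd
  rw [Cmd.wp_seq]
  refine wp_mateCmd (κ := κ) h hb' (by decide) (by decide) (by decide) fun V₁ h₁ r₁ f₁ => ?_
  have b₁ := f₁.reg 24 (by decide)
  have hm : V₁.reg 13 < N := r₁ ▸ mate_lt hb'
  rw [Cmd.wp_seq]
  refine wp_loadFstOf (κ := κ) h₁ hN (b₁ ▸ hb') (by decide) fun V₂ h₂ r₂ f₂ => ?_
  have b₂ := f₂.reg 13 (by decide)
  refine wp_loadSnd (κ := κ) h₂ hN (b₂ ▸ hm) (by decide) fun V₃ h₃ r₃ f₃ => ?_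
  have e₃ := (f₃.reg 13 (by decide)).trans (b₂.trans r₁)
  refine hQ V₃ h₃ e₃ ?_ ?_ (((f₁.trans f₂).trans f₃).mono (by decide))
  · rw [f₃.reg 11 (by decide), r₂, r₁, b₁, fstWord, hmm]
    grind
  · rw [r₃, b₂, r₁, sndWord, hmm]
    grind

theorem wp_removeCmd (h : Stores w L N V A B μ) (hN : 2 * N ≤ 2 ^ w) (hμ : 0 < μ) (hμN : μ ≤ N)
    (hb : V.reg 10 < N)
    (hQ : ∀ V', Stores w L N V' (removeA A N μ (V.reg 10)) (removeB A B N μ (V.reg 10)) (μ - 1) →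
      Frame [8, 13, 15, 16, 17, 19, 20, 30, 31] V V' → Q V') :
    removeCmd.wp κ (2 * N) Q V := by
  unfold removeCmd
  have hs : BinOp.natEval w .sub μ 1 = μ - 1 := natEval_sub (by omega) hμ
  have he : μ - 1 < N := by omega
  rw [Cmd.wp_seq]
  refine wp_mateCmd (κ := κ) h hb (by decide) (by decide) (by decide) fun V₁ h₁ r₁ f₁ => ?_
  rw [Cmd.wp_seq]
  refine wp_op (m := 2 * N) (κ := κ) h₁ (by decide) (by rw [h₁.barrier, h₁.one, hs])
    fun V₂ h₂ r₂ f₂ => ?_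
  rw [Cmd.wp_seq]
  refine wp_mateCmd (κ := κ) h₂ (by omega) (by decide) (by decide) (by decide) fun V₃ h₃ r₃ f₃ => ?_
  rw [r₂] at r₃
  have e₃ : V₃.reg 15 = μ - 1 := (f₃.reg 15 (by decide)).trans r₂
  rw [Cmd.wp_seq]
  refine wp_loadFstOf (κ := κ) h₃ hN (by omega) (by decide) fun V₄ h₄ r₄ f₄ => ?_
  rw [r₃, e₃] at r₄
  have g₄ := ((f₁.trans f₂).trans f₃).trans f₄
  have a₄ : V₄.reg 13 = mate A N μ (V.reg 10) :=
    (((f₂.trans f₃).trans f₄).reg 13 (by decide)).trans r₁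
  rw [Cmd.wp_seq]
  refine wp_storeSnd (κ := κ) h₄ hN (a₄ ▸ mate_lt hb) (by decide) fun V₅ h₅ f₅ => ?_
  have a₅ := (f₅.reg 13 (by decide)).trans a₄
  have e₅ : V₅.reg 16 = _ := ((f₄.trans f₅).reg 16 (by decide)).trans r₃
  rw [Cmd.wp_seq]
  refine wp_storeFst (κ := κ) h₅ (a₅ ▸ mate_lt hb) fun V₆ h₆ f₆ => ?_
  have a₆ := (f₆.reg 13 (by decide)).trans a₅
  have e₆ := (f₆.reg 16 (by decide)).trans e₅
  rw [Cmd.wp_seq]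
  refine wp_storeFst (κ := κ) h₆ (e₆ ▸ mate_lt he) fun V₇ h₇ f₇ => ?_
  refine wp_op_barrier (κ := κ) h₇ (by rw [h₇.barrier, h₇.one, hs]) fun V₈ h₈ f₈ => ?_
  refine hQ V₈ ?_ (((((g₄.trans f₅).trans f₆).trans f₇).trans f₈).mono (by decide))
  rw [e₆, a₆, a₅, e₅, a₄, r₄] at h₈
  exact h₈

theorem wp_unlinkCmd (h : Stores w L N V A B μ) {v : Fin 32} (hv : V.reg v < N)
    (hv' : v ∉ [19, 30, 31])
    (hQ : ∀ V', Stores w L N V' (unlink A N μ (V.reg v)) B μ → Frame [19, 30, 31] V V' → Q V') :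
    (unlinkCmd v).wp κ (2 * N) Q V := by
  simp only [List.mem_cons, List.not_mem_nil, or_false, not_or] at hv'
  unfold unlinkCmd
  rw [Cmd.wp_seq]
  refine wp_mateCmd (κ := κ) h hv (by decide) (by simp [Ne.symm hv'.1]) (by simp [hv'])
    fun V₁ h₁ r₁ f₁ => ?_
  have b₁ := f₁.reg v (by simp [hv'])
  rw [Cmd.wp_ifEq, r₁, b₁]
  split_ifs with c
  · exact hQ V₁ (by rwa [unlink, if_pos c]) f₁
  · refine wp_storeFst (κ := κ) h₁ (r₁ ▸ mate_lt hv) fun V₂ h₂ f₂ => hQ V₂ ?_ (f₁.trans f₂)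
    rwa [unlink, if_neg c, ← r₁]

theorem wp_addCmd (h : Stores w L N V A B μ) (hN : 2 * N ≤ 2 ^ w) (hμN : μ < N)
    (hb : V.reg 10 < N)
    (hQ : ∀ V', Stores w L N V' (addA A B N μ (V.reg 10) (V.reg 11))
        (addB A B N μ (V.reg 10) (V.reg 11) (V.reg 12)) (μ + 1) →
      Frame [8, 13, 15, 16, 17, 18, 19, 20, 30, 31] V V' → Q V') :
    addCmd.wp κ (2 * N) Q V := by
  unfold addCmd
  have hs : BinOp.natEval w .add μ 1 = μ + 1 := by
    rw [BinOp.natEval, Nat.mod_eq_of_lt (by omega)]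
  rw [Cmd.wp_seq]
  refine wp_mateCmd (κ := κ) h (h.barrier ▸ hμN) (by decide) (by decide) (by decide)
    fun V₁ h₁ r₁ f₁ => ?_
  rw [h.barrier] at r₁
  have b₁ := f₁.reg 10 (by decide)
  rw [Cmd.wp_seq]
  refine wp_mateCmd (κ := κ) h₁ (b₁ ▸ hb) (by decide) (by decide) (by decide) fun V₂ h₂ r₂ f₂ => ?_
  rw [b₁] at r₂
  rw [Cmd.wp_seq]
  refine wp_move (m := 2 * N) (κ := κ) h₂ (by decide) fun V₃ h₃ r₃ f₃ => ?_
  rw [h₂.barrier] at r₃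
  have g₃ := (f₁.trans f₂).trans f₃
  have b₃ := g₃.reg 10 (by decide)
  have c₃ : V₃.reg 13 = _ := (f₃.reg 13 (by decide)).trans r₂
  rw [Cmd.wp_seq]
  refine wp_ifEq_join (Q' := fun V' => Stores w L N V' A B μ ∧ Frame [17, 20] V₃ V' ∧
    V'.reg 17 = if mate A N μ (V.reg 10) = V.reg 10 then V.reg 11 else B (V.reg 10))
    (fun c => ?_) (fun c => ?_) ?_
  · refine wp_move (m := 2 * N) (κ := κ) h₃ (by decide)
      fun V₄ h₄ r₄ f₄ => ⟨h₄, f₄.mono (by decide), ?_⟩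
    rw [c₃, b₃] at c
    rw [r₄, if_pos c, g₃.reg 11 (by decide)]
  · refine wp_loadSnd (κ := κ) h₃ hN (b₃ ▸ hb) (by decide) fun V₄ h₄ r₄ f₄ => ⟨h₄, f₄, ?_⟩
    rw [c₃, b₃] at c
    rw [r₄, if_neg c, b₃]
  rintro V₄ ⟨h₄, f₄, r₄⟩
  have g₄ := g₃.trans f₄
  have a₄ : V₄.reg 16 = _ := (((f₂.trans f₃).trans f₄).reg 16 (by decide)).trans r₁
  have e₄ := (f₄.reg 15 (by decide)).trans r₃
  rw [Cmd.wp_seq]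
  refine wp_ifEq_join (Q' := fun V' => Stores w L N V' (if mate A N μ μ = μ then A else
    Function.update A μ (B (mate A N μ μ))) B μ ∧ Frame [18, 20] V₄ V')
    (fun c => ?_) (fun c => ?_) ?_
  · rw [a₄, e₄] at c
    exact ⟨by rwa [if_pos c], (Frame.refl _ _)⟩
  · rw [Cmd.wp_seq]
    refine wp_loadSnd (κ := κ) h₄ hN (a₄ ▸ mate_lt hμN) (by decide) fun V₅ h₅ r₅ f₅ => ?_
    have e₅ := (f₅.reg 15 (by decide)).trans e₄
    refine wp_storeFst (κ := κ) h₅ (e₅ ▸ hμN) fun V₆ h₆ f₆ => ⟨?_, (f₅.trans f₆).mono (by decide)⟩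
    rw [a₄, e₄] at c
    rw [if_neg c]
    rwa [e₅, r₅, a₄] at h₆
  rintro V₅ ⟨h₅, f₅⟩
  have g₅ := g₄.trans f₅
  have a₅ := (f₅.reg 16 (by decide)).trans a₄
  have e₅ := (f₅.reg 15 (by decide)).trans e₄
  have c₅ := ((f₄.trans f₅).reg 13 (by decide)).trans c₃
  have x₅ := (f₅.reg 17 (by decide)).trans r₄
  rw [Cmd.wp_seq]
  refine wp_ifEq_join (Q' := fun V' => Stores w L N V' (linkA A B N μ (V.reg 10))
    (if mate A N μ (V.reg 10) = μ then B else Function.update B (mate A N μ μ)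
      (if mate A N μ (V.reg 10) = V.reg 10 then V.reg 11 else B (V.reg 10))) μ ∧ Frame [20] V₅ V')
    (fun c => ?_) (fun c => ?_) ?_
  · rw [c₅, e₅] at c
    exact ⟨by rwa [linkA, if_pos c, if_pos c], Frame.refl _ _⟩
  · rw [c₅, e₅] at c
    rw [Cmd.wp_seq]
    refine wp_storeSnd (κ := κ) h₅ hN (a₅ ▸ mate_lt hμN) (by decide) fun V₆ h₆ f₆ => ?_
    have a₆ := (f₆.reg 16 (by decide)).trans a₅
    have c₆ := (f₆.reg 13 (by decide)).trans c₅
    rw [Cmd.wp_seq]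
    refine wp_storeFst (κ := κ) h₆ (a₆ ▸ mate_lt hμN) fun V₇ h₇ f₇ => ?_
    have a₇ := (f₇.reg 16 (by decide)).trans a₆
    have c₇ := (f₇.reg 13 (by decide)).trans c₆
    refine wp_storeFst (κ := κ) h₇ (c₇ ▸ mate_lt hb) fun V₈ h₈ f₈ =>
      ⟨?_, ((f₆.trans f₇).trans f₈).mono (by decide)⟩
    rw [linkA, if_neg c, if_neg c]
    rwa [c₇, a₇, a₆, c₆, a₅, x₅] at h₈
  rintro V₆ ⟨h₆, f₆⟩
  rw [Cmd.wp_seq]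
  refine wp_op_barrier (κ := κ) h₆ (by rw [h₆.barrier, h₆.one, hs]) fun V₇ h₇ f₇ => ?_
  have g₇ := (g₅.trans f₆).trans f₇
  have b₇ := g₇.reg 10 (by decide)
  rw [Cmd.wp_seq]
  refine wp_storeSnd (κ := κ) h₇ hN (b₇ ▸ hb) (by decide) fun V₈ h₈ f₈ => ?_
  have g₈ := g₇.trans f₈
  have b₈ := g₈.reg 10 (by decide)
  rw [b₇, g₇.reg 12 (by decide)] at h₈
  rw [Cmd.wp_seq]
  refine wp_ifLt_join (Q' := fun V' => Stores w L N V' (if V.reg 10 < μ + 1 then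
      unlink (Function.update (linkA A B N μ (V.reg 10)) (V.reg 10) (V.reg 11)) N (μ + 1) (V.reg 10)
    else linkA A B N μ (V.reg 10))
    (addB A B N μ (V.reg 10) (V.reg 11) (V.reg 12)) (μ + 1) ∧ Frame [19, 30, 31] V₈ V')
    (fun c => ?_) (fun c => ?_) ?_
  · rw [b₈, h₈.barrier] at c
    rw [Cmd.wp_seq]
    refine wp_storeFst (κ := κ) h₈ (b₈ ▸ hb) fun V₉ h₉ f₉ => ?_
    have b₉ := (f₉.reg 10 (by decide)).trans b₈
    refine wp_unlinkCmd h₉ (b₉ ▸ hb) (by decide) fun V' h' f' =>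
      ⟨?_, (f₉.trans f').mono (by decide)⟩
    rw [if_pos c]
    rwa [b₉, b₈, g₈.reg 11 (by decide)] at h'
  · rw [b₈, h₈.barrier] at c
    exact ⟨by rwa [if_neg c], Frame.refl _ _⟩
  rintro V₉ ⟨h₉, f₉⟩
  have g₉ := g₈.trans f₉
  have t := ((f₆.trans f₇).trans f₈).trans f₉
  have a₉ := (t.reg 16 (by decide)).trans a₅
  have e₉ := (t.reg 15 (by decide)).trans e₅
  rw [Cmd.wp_ifEq, a₉, e₉]
  split_ifs with c
  · exact hQ V₉ (by rwa [addA, if_pos c]) (g₉.mono (by decide))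
  · refine wp_unlinkCmd h₉ (e₉ ▸ hμN) (by decide) fun V' h' f' =>
      hQ V' ?_ ((g₉.trans f').mono (by decide))
    rw [addA, if_neg c]
    rwa [e₉] at h'

end

/-! ### The bit vector and the programs for the set operations -/

/-- The `q`-th of the `2 * N` words that make up the bit vector represented. -/
def bitWord (A B : ℕ → ℕ) (N μ q : ℕ) : ℕ :=
  if q < N then fstWord A B N μ q else sndWord A B N μ (q - N)

/-- The contents `V` represent the set `S`. -/
def Represents (w L N : ℕ) (V : NatState 31) (S : Finset ℕ) : Prop :=
  ∃ A B μ, Stores w L N V A B μ ∧ Valid A B N μ ∧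
    ∀ i, i ∈ S ↔ i / w < 2 * N ∧ (bitWord A B N μ (i / w)).testBit (i % w) = true

/-- Find the element of the lowest bit of word `11`, where `9` is the index of the word. -/
def elementCmd : Cmd 31 6 :=
  .op .sub 23 11 2 ;; .op .xor 23 11 23 ;; .op .and 21 11 23 ;;
  .op .mod 25 21 4 ;;
  .op .div 26 21 25 ;; .op .sub 26 26 2 ;; .op .div 26 26 4 ;; .op .mod 26 26 4 ;;
  .op .mul 26 26 5 ;;
  .op .shr 27 6 25 ;; .op .shl 28 2 25 ;; .op .mod 27 27 28 ;;
  .op .add 22 26 27 ;;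
  .op .mul 23 9 3 ;; .op .add 23 23 22

/-- Write all elements of the word `11` with index `9` to the output. -/
def emitWordCmd : Cmd 31 6 :=
  .whileLt 1 11 (elementCmd ;; .emit 23 ;; .op .sub 11 11 21)

def enumerateCmd : Cmd 31 6 :=
  move 24 1 ;;
  .whileLt 24 8
    ((pickCmd ;; move 9 13) ;; emitWordCmd ;;
      (.op .add 9 13 7 ;; move 11 12) ;; emitWordCmd ;; .op .add 24 24 2)

def findanyCmd : Cmd 31 6 :=
  .ifEq 8 1 (move 0 1)
    (move 24 1 ;; pickCmd ;;
      .ifEq 11 1 (move 11 12 ;; .op .add 9 13 7) (move 9 13) ;;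
      elementCmd ;; move 0 23)

/-- Locate the word `9`, the block `10` and the bit `14` of the element `0`. -/
def locateCmd : Cmd 31 6 :=
  .op .div 9 0 3 ;; .op .mod 14 0 3 ;; .ifLt 9 7 (move 10 9) (.op .sub 10 9 7)

def searchCmd : Cmd 31 6 :=
  locateCmd ;; readCmd ;; .ifLt 9 7 (move 0 11) (move 0 12) ;;
  .op .shr 0 0 14 ;; .op .and 0 0 2

/-- Change the word of the element `0` by the program `e`, which finds the bit in register `14`. -/
def updateCmd (e : Fin 32 → Cmd 31 6) : Cmd 31 6 :=
  locateCmd ;; .op .shl 14 2 14 ;; readCmd ;;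
  .op .or 29 11 12 ;; .ifEq 29 1 .skip removeCmd ;;
  .ifLt 9 7 (e 11) (e 12) ;;
  .op .or 29 11 12 ;; .ifEq 29 1 .skip addCmd

def insertCmd : Cmd 31 6 := updateCmd fun d => .op .or d d 14

def deleteCmd : Cmd 31 6 := updateCmd fun d => .op .or d d 14 ;; .op .xor d d 14

def setupCmd : Cmd 31 6 :=
  .const 1 0 ;; .const 2 1 ;; .const 3 2 ;; .const 4 3 ;; .const 5 4 ;; .const 6 5 ;;
  .op .add 9 3 3 ;; .op .div 7 0 9 ;; .op .add 7 7 2 ;; .const 8 0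

/-! ### Extracting the elements of a word -/

section

variable {w L N μ : ℕ} {V : NatState 31} {A B : ℕ → ℕ} {κ : Fin 6 → BitVec w}
  {Q : NatState 31 → Prop}

theorem wp_elementCmd (h : Stores w L N V A B μ) (hw : 16 ≤ w)
    (hL : ∀ b < Nat.log 2 w, L / 2 ^ 2 ^ b % 2 ^ 2 ^ b = b) {x q m : ℕ}
    (hx : V.reg 11 = x) (hq : V.reg 9 = q) (hx₀ : x ≠ 0) (hxw : x < 2 ^ w)
    (hbit : ∀ j, x.testBit j = true → q * w + j < 2 ^ w)
    (hQ : ∀ V' j, Stores w L N V' A B μ → x.testBit j = true → 2 ^ j ≤ x →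
      (∀ i, (x - 2 ^ j).testBit i = true ↔ x.testBit i = true ∧ i ≠ j) →
      V'.reg 21 = 2 ^ j → V'.reg 23 = q * w + j →
      Frame [21, 22, 23, 25, 26, 27, 28] V V' → Q V') :
    elementCmd.wp κ m Q V := by
  obtain ⟨j, hj, hxj, hjx, hjb⟩ := lowest_bit hx₀
  have hjq := hbit j hj
  have hjw : j < w := (Nat.pow_lt_pow_iff_right (by norm_num)).1 (hjx.trans_lt hxw)
  set s := Nat.log 2 w with hs
  have hs4 : 4 ≤ s := Nat.le_log_of_pow_le (by norm_num) (by omega)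
  have hsw : w < 2 ^ (s + 1) := Nat.lt_pow_succ_log_self (by norm_num) w
  have hws : 2 ^ s ≤ w := Nat.pow_log_le_self 2 (by omega)
  have hlog := log_formula hs4 hsw hL hjw
  have hu := pow_mod_pred s j (by omega)
  have hww : w < 2 ^ w := Nat.lt_two_pow_self
  have hus : 2 ^ (j % s) < 2 ^ s :=
    Nat.pow_lt_pow_right (by norm_num) (Nat.mod_lt _ (by omega))
  have h2j : 1 ≤ 2 ^ j / (2 ^ j % (2 ^ s - 1)) := by
    rw [hu, Nat.one_le_div_iff (by positivity)]
    exact Nat.pow_le_pow_right (by norm_num) (Nat.mod_le _ _)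
  have h2j' : 2 ^ j / (2 ^ j % (2 ^ s - 1)) < 2 ^ w :=
    (Nat.div_le_self _ _).trans_lt (hjx.trans_lt hxw)
  have hsub : BinOp.natEval w .sub x 1 = x - 1 := natEval_sub hxw (by omega)
  unfold elementCmd
  rw [Cmd.wp_seq]
  refine wp_op (v := x - 1) h (by decide) (by rw [hx, h.one, hsub]) fun V₁ h₁ r₁ f₁ => ?_
  rw [Cmd.wp_seq]
  refine wp_op (v := x ^^^ (x - 1)) h₁ (by decide)
    (by rw [f₁.reg 11 (by decide), hx, r₁]; rfl) fun V₂ h₂ r₂ f₂ => ?_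
  rw [Cmd.wp_seq]
  refine wp_op (v := 2 ^ j) h₂ (by decide)
    (by rw [(f₁.trans f₂).reg 11 (by decide), hx, r₂]; exact hxj) fun V₃ h₃ r₃ f₃ => ?_
  have g₃ := (f₁.trans f₂).trans f₃
  rw [Cmd.wp_seq]
  refine wp_op (v := 2 ^ j % (2 ^ s - 1)) h₃ (by decide) (by rw [r₃, h₃.ones]; rfl)
    fun V₄ h₄ r₄ f₄ => ?_
  rw [Cmd.wp_seq]
  refine wp_op (v := 2 ^ j / (2 ^ j % (2 ^ s - 1))) h₄ (by decide)
    (by rw [f₄.reg 21 (by decide), r₃, r₄]; rfl) fun V₅ h₅ r₅ f₅ => ?_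
  rw [Cmd.wp_seq]
  refine wp_op (v := 2 ^ j / (2 ^ j % (2 ^ s - 1)) - 1) h₅ (by decide)
    (by rw [r₅, h₅.one]; exact natEval_sub h2j' h2j) fun V₆ h₆ r₆ f₆ => ?_
  rw [Cmd.wp_seq]
  refine wp_op h₆ (by decide) (by rw [r₆, h₆.ones, BinOp.natEval]) fun V₇ h₇ r₇ f₇ => ?_
  rw [Cmd.wp_seq]
  refine wp_op h₇ (by decide) (by rw [r₇, h₇.ones, BinOp.natEval]) fun V₈ h₈ r₈ f₈ => ?_
  rw [← hs] at r₈
  rw [Cmd.wp_seq]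
  refine wp_op h₈ (by decide)
    (by rw [r₈, h₈.log, BinOp.natEval, ← hs, Nat.mod_eq_of_lt (by omega)]) fun V₉ h₉ r₉ f₉ => ?_
  have g₉ := ((((g₃.trans f₄).trans f₅).trans f₆).trans f₇).trans f₈ |>.trans f₉
  have u₉ := ((((f₅.trans f₆).trans f₇).trans f₈).trans f₉).reg 25 (by decide) |>.trans r₄
  rw [Cmd.wp_seq]
  refine wp_op h₉ (by decide) (by rw [u₉, h₉.table, BinOp.natEval]) fun V₁₀ h₁₀ r₁₀ f₁₀ => ?_
  have u₁₀ := (f₁₀.reg 25 (by decide)).trans u₉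
  rw [Cmd.wp_seq]
  refine wp_op (v := 2 ^ (2 ^ j % (2 ^ s - 1))) h₁₀ (by decide) (by
    rw [u₁₀, h₁₀.one, BinOp.natEval, one_mul, Nat.mod_eq_of_lt]
    rw [hu]
    exact Nat.pow_lt_pow_right (by norm_num) (by omega)) fun V₁₁ h₁₁ r₁₁ f₁₁ => ?_
  rw [Cmd.wp_seq]
  refine wp_op h₁₁ (by decide)
    (by rw [r₁₁, f₁₁.reg 27 (by decide), r₁₀, BinOp.natEval]) fun V₁₂ h₁₂ r₁₂ f₁₂ => ?_
  rw [Cmd.wp_seq]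
  refine wp_op (v := j) h₁₂ (by decide) (by
    rw [r₁₂, ((f₁₀.trans f₁₁).trans f₁₂).reg 26 (by decide), r₉, BinOp.natEval, hlog,
      Nat.mod_eq_of_lt (by omega)]) fun V₁₃ h₁₃ r₁₃ f₁₃ => ?_
  have g₁₃ := ((g₉.trans f₁₀).trans f₁₁).trans f₁₂ |>.trans f₁₃
  rw [Cmd.wp_seq]
  refine wp_op (v := q * w) h₁₃ (by decide) (by
    rw [g₁₃.reg 9 (by decide), hq, h₁₃.width, BinOp.natEval, Nat.mod_eq_of_lt (by omega)])
    fun V₁₄ h₁₄ r₁₄ f₁₄ => ?_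
  refine wp_op (v := q * w + j) h₁₄ (by decide) (by
    rw [f₁₄.reg 22 (by decide), r₁₄, r₁₃, BinOp.natEval, Nat.mod_eq_of_lt hjq])
    fun V₁₅ h₁₅ r₁₅ f₁₅ => ?_
  have g₁₅ := (g₁₃.trans f₁₄).trans f₁₅
  refine hQ V₁₅ j h₁₅ hj hjx hjb ?_ r₁₅ (g₁₅.mono (by decide))
  rw [((((f₄.trans f₅).trans f₆).trans f₇).trans f₈ |>.trans f₉ |>.trans f₁₀ |>.trans f₁₁
    |>.trans f₁₂ |>.trans f₁₃ |>.trans f₁₄ |>.trans f₁₅).reg 21 (by decide), r₃]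

theorem triple_emitWordCmd (hw : 16 ≤ w)
    (hL : ∀ b < Nat.log 2 w, L / 2 ^ 2 ^ b % 2 ^ 2 ^ b = b) {q m : ℕ} (x : ℕ) (hxw : x < 2 ^ w)
    (hbit : ∀ j, x.testBit j = true → q * w + j < 2 ^ w)
    {V : NatState 31} (h : Stores w L N V A B μ) (hx : V.reg 11 = x) (hq : V.reg 9 = q) :
    Triple κ m emitWordCmd V fun t V' => Stores w L N V' A B μ ∧
      (∀ d ∉ [11, 21, 22, 23, 25, 26, 27, 28], V'.reg d = V.reg d) ∧
      ∃ l, V'.out = l ++ V.out ∧ l.Nodup ∧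
        (∀ v, v ∈ l ↔ v / w = q ∧ x.testBit (v % w) = true) ∧ t ≤ 19 * l.length + 2 := by
  induction x using Nat.strong_induction_on generalizing V with
  | _ x ih =>
    by_cases hx₀ : x = 0
    · refine .whileLt_of_not_lt (by rw [h.zero, hx]; omega) ⟨h, fun _ _ => rfl, [], rfl, ?_⟩
      simp [hx₀]
    · refine .whileLt_of_lt (by rw [h.zero, hx]; omega) ?_
      refine (Triple.of_wp (Q := fun V' => ∃ j, Stores w L N V' A B μ ∧ x.testBit j = true ∧
        2 ^ j ≤ x ∧ (∀ i, (x - 2 ^ j).testBit i = true ↔ x.testBit i = true ∧ i ≠ j) ∧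
        V'.reg 11 = x - 2 ^ j ∧ V'.out = (q * w + j) :: V.out ∧
        (∀ d ∉ [11, 21, 22, 23, 25, 26, 27, 28], V'.reg d = V.reg d)) ?_).mono ?_
      · rw [Cmd.wp_seq]
        refine wp_elementCmd h hw hL hx hq hx₀ hxw hbit fun V₁ j h₁ hj hjx hjb r₁ e₁ f₁ => ?_
        have hs : BinOp.natEval w .sub x (2 ^ j) = x - 2 ^ j := natEval_sub hxw hjx
        have hx₁ := (f₁.reg 11 (by decide)).trans hx
        rw [Cmd.wp_seq, Cmd.wp_emit]
        refine wp_op (h₁.write _) (by decide)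
          (by simp only [NatState.reg_write]; rw [hx₁, r₁, hs])
          fun V₂ h₂ r₂ f₂ => ?_
        refine ⟨j, h₂, hj, hjx, hjb, r₂, ?_, fun d hd => ?_⟩
        · rw [f₂.out, NatState.out_write, e₁, f₁.out]
        · rw [f₂.reg d (fun h => hd (by revert h; simp +contextual)), NatState.reg_write,
            f₁.reg d (fun h => hd (List.mem_cons_of_mem _ h))]
      · rintro t V₁ ⟨ht, j, h₁, hj, hjx, hjb, r₁, o₁, f₁⟩
        have hpos : 0 < 2 ^ j := by positivity
        have hjw : j < w := (Nat.pow_lt_pow_iff_right (by norm_num)).1 (hjx.trans_lt hxw)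
        refine (ih (x - 2 ^ j) (by omega) (by omega) (fun i hi => hbit i ((hjb i).1 hi).1) h₁ r₁
          ((f₁ 9 (by decide)).trans hq)).mono ?_
        rintro t' V₂ ⟨h₂, f₂, l, hl, hln, hlm, ht'⟩
        have hdiv : (q * w + j) / w = q := by
          rw [mul_comm, Nat.mul_add_div (by omega), Nat.div_eq_of_lt hjw, Nat.add_zero]
        have hmod : (q * w + j) % w = j := by
          rw [mul_comm, Nat.mul_add_mod, Nat.mod_eq_of_lt hjw]
        refine ⟨h₂, fun d hd => (f₂ d hd).trans (f₁ d hd), l ++ [q * w + j], ?_, ?_,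
          fun v => ?_, ?_⟩
        · rw [hl, o₁]; simp
        · rw [List.nodup_append]
          refine ⟨hln, by simp, fun v hv u hu => ?_⟩
          rintro rfl
          rw [List.mem_singleton] at hu
          subst hu
          have := (hlm _).1 hv
          rw [hmod, hjb] at this
          exact this.2.2 rfl
        · rw [List.mem_append, List.mem_singleton, hlm, hjb]
          constructor
          · rintro (⟨h, h', -⟩ | rfl)
            · exact ⟨h, h'⟩
            · rw [hdiv, hmod]; exact ⟨rfl, hj⟩
          · rintro ⟨h, h'⟩
            by_cases hv : v % w = j
            · right
              rw [← Nat.div_add_mod v w, h, hv, mul_comm]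
            · exact .inl ⟨h, h', hv⟩
        -- Fifteen steps to find the element and two to write it out and clear its bit; with the two
        -- jumps of the loop each element costs `19`.
        · have hc : (elementCmd ;; Cmd.emit 23 ;; Cmd.op .sub 11 11 21).cost = 17 := rfl
          rw [List.length_append, List.length_singleton]
          omega

end

/-! ### Enumeration over the blocks in front of the barrier -/

section

variable {w L N μ : ℕ} {V : NatState 31} {A B : ℕ → ℕ} {κ : Fin 6 → BitVec w}
  {Q : NatState 31 → Prop}

theorem fstWord_lt {k : ℕ} (hk : 0 < k) (hA : ∀ b < N, A b < k) (hB : ∀ b < N, B b < k) {b : ℕ}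
    (hb : b < N) : fstWord A B N μ b < k := by
  have := hB _ (mate_lt (A := A) (μ := μ) hb)
  have := hA b hb
  unfold fstWord
  split_ifs <;> assumption

theorem sndWord_lt {k : ℕ} (hk : 0 < k) (hB : ∀ b < N, B b < k) {b : ℕ}
    (hb : b < N) : sndWord A B N μ b < k := by
  have := hB b hb
  unfold sndWord
  split_ifs <;> assumption

theorem bitWord_fst {c : ℕ} (hc : c < N) : bitWord A B N μ c = fstWord A B N μ c := if_pos hc

theorem bitWord_snd {c : ℕ} : bitWord A B N μ (N + c) = sndWord A B N μ c := by
  rw [bitWord, if_neg (by omega), Nat.add_sub_cancel_left]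

/-- The block that contains the word `q`. -/
def blockOf (N q : ℕ) : ℕ := if q < N then q else q - N

theorem blockOf_lt {q : ℕ} (hq : q < 2 * N) : blockOf N q < N := by
  unfold blockOf; split_ifs <;> omega

theorem blockOf_eq_iff {q c : ℕ} (hq : q < 2 * N) (hc : c < N) :
    blockOf N q = c ↔ q = c ∨ q = N + c := by
  unfold blockOf; split_ifs <;> omega

/-- A nonempty block is its own mate in front of the barrier, or lies behind it with its mate in
front. Hence the loop over the blocks in front reaches every nonzero word. -/
theorem mate_blockOf_lt {q : ℕ} (h : bitWord A B N μ q ≠ 0)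
    (hq : q < 2 * N) : mate A N μ (blockOf N q) < μ := by
  have hb := blockOf_lt hq
  have hne : ¬ (fstWord A B N μ (blockOf N q) = 0 ∧ sndWord A B N μ (blockOf N q) = 0) := by
    unfold bitWord at h
    unfold blockOf
    split_ifs at h ⊢ <;> tauto
  have h₁ := iff_mate_of_ne_zero hne
  have h₂ := mate_cases A N μ (blockOf N q)
  omega

theorem ne_zero_of_testBit {x i : ℕ} (h : x.testBit i = true) : x ≠ 0 := by
  rintro rfl; simp at h

/-- The loop of the enumeration from block `24` on. -/
theorem triple_enumerate_loop (hw : 16 ≤ w) (hN : 2 * N ≤ 2 ^ w)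
    (hL : ∀ b < Nat.log 2 w, L / 2 ^ 2 ^ b % 2 ^ 2 ^ b = b)
    (hA : ∀ b < N, A b < 2 ^ w) (hB : ∀ b < N, B b < 2 ^ w) (hv : Valid A B N μ)
    (hbit : ∀ q < 2 * N, ∀ j, (bitWord A B N μ q).testBit j = true → q * w + j < 2 ^ w)
    {V : NatState 31} (h : Stores w L N V A B μ) (hμ : V.reg 24 ≤ μ) :
    Triple κ (2 * N) (.whileLt 24 8
      ((pickCmd ;; move 9 13) ;; emitWordCmd ;;
        (.op .add 9 13 7 ;; move 11 12) ;; emitWordCmd ;; .op .add 24 24 2)) V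
      fun t V' => Stores w L N V' A B μ ∧ ∃ l, V'.out = l ++ V.out ∧ l.Nodup ∧
        (∀ v, v ∈ l ↔ (v / w < 2 * N ∧ (bitWord A B N μ (v / w)).testBit (v % w) = true) ∧
          V.reg 24 ≤ mate A N μ (blockOf N (v / w))) ∧ t ≤ 200 * l.length + 2 := by
  obtain ⟨k, hk⟩ : ∃ k, V.reg 24 + k = μ := ⟨μ - V.reg 24, by omega⟩
  induction k generalizing V with
  | zero =>
    refine .whileLt_of_not_lt (by rw [h.barrier]; omega) ⟨h, [], rfl, List.nodup_nil, ?_, by simp⟩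
    simp only [List.not_mem_nil, false_iff]
    rintro v ⟨⟨h₁, h₂⟩, h₃⟩
    have := mate_blockOf_lt (ne_zero_of_testBit h₂) h₁
    omega
  | succ k ih =>
    set j := V.reg 24 with hj
    have hle := hv.le
    have hjN : j < N := by omega
    have hjμ : j < μ := by omega
    set c := mate A N μ j with hc
    have hcN : c < N := mate_lt hjN
    have hcj : mate A N μ c = j := mate_mate A hjN
    have hww : 0 < 2 ^ w := by positivity
    have hNw : N < 2 ^ w := by omega
    -- The mate `c` of `j < μ` is always the nonempty member: it is `j` itself or lies behind the
    -- barrier with a partner.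
    have hne := hv.ne_zero c hcN (by
      rw [hcj]
      have := mate_cases A N μ j
      omega)
    refine .whileLt_of_lt (by rw [h.barrier]; omega) (.seq ?_)
    refine (Triple.of_wp (Q := fun V' => Stores w L N V' A B μ ∧ V'.reg 9 = c ∧ V'.reg 13 = c ∧
      V'.reg 11 = fstWord A B N μ c ∧ V'.reg 12 = sndWord A B N μ c ∧
      V'.reg 24 = j ∧ V'.out = V.out) ?_).mono ?_
    · rw [Cmd.wp_seq]
      refine wp_pickCmd h hN hle hjμ fun V₁ h₁ r₁ x₁ y₁ f₁ => ?_
      refine wp_move h₁ (by decide) fun V₂ h₂ r₂ f₂ => ?_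
      exact ⟨h₂, r₂.trans r₁, (f₂.reg 13 (by decide)).trans r₁,
        (f₂.reg 11 (by decide)).trans x₁, (f₂.reg 12 (by decide)).trans y₁,
        (f₁.trans f₂).reg 24 (by decide), (f₁.trans f₂).out⟩
    rintro t₁ V₁ ⟨ht₁, h₁, q₁, c₁, x₁, y₁, j₁, o₁⟩
    have hcost : (pickCmd ;; move 9 13).cost ≤ 50 := by decide
    refine .seq ((triple_emitWordCmd hw hL _ (fstWord_lt hww hA hB hcN) (fun i hi =>
      hbit c (by omega) i (by rwa [bitWord_fst hcN])) h₁ x₁ q₁).mono ?_)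
    rintro t₂ V₂ ⟨h₂, f₂, l₂, o₂, n₂, m₂, ht₂⟩
    refine .seq ((Triple.of_wp (Q := fun V' => Stores w L N V' A B μ ∧ V'.reg 9 = N + c ∧
      V'.reg 11 = sndWord A B N μ c ∧ V'.reg 24 = j ∧ V'.out = l₂ ++ V.out) ?_).mono ?_)
    · rw [Cmd.wp_seq]
      refine wp_op (v := N + c) h₂ (by decide) (by
        rw [f₂ 13 (by decide), c₁, h₂.size, BinOp.natEval, Nat.mod_eq_of_lt (by omega),
          Nat.add_comm]) fun V₃ h₃ r₃ f₃ => ?_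
      refine wp_move h₃ (by decide) fun V₄ h₄ r₄ f₄ => ?_
      refine ⟨h₄, (f₄.reg 9 (by decide)).trans r₃, ?_, ?_, ?_⟩
      · rw [r₄, f₃.reg 12 (by decide), f₂ 12 (by decide), y₁]
      · rw [(f₃.trans f₄).reg 24 (by decide), f₂ 24 (by decide), j₁]
      · rw [(f₃.trans f₄).out, o₂, o₁]
    rintro t₃ V₃ ⟨ht₃, h₃, q₃, x₃, j₃, o₃⟩
    have hcost' : (Cmd.op (R := 31) (K := 6) .add 9 13 7 ;; move 11 12).cost = 2 := rfl
    refine .seq ((triple_emitWordCmd hw hL _ (sndWord_lt hww hB hcN) (fun i hi =>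
      hbit (N + c) (by omega) i (by rwa [bitWord_snd])) h₃ x₃ q₃).mono ?_)
    rintro t₄ V₄ ⟨h₄, f₄, l₄, o₄, n₄, m₄, ht₄⟩
    have j₄ := (f₄ 24 (by decide)).trans j₃
    refine (Triple.of_wp (Q := fun V' => Stores w L N V' A B μ ∧ V'.reg 24 = j + 1 ∧
      V'.out = V₄.out) ?_).mono ?_
    · refine wp_op (v := j + 1) h₄ (by decide) (by
        rw [j₄, h₄.one, BinOp.natEval, Nat.mod_eq_of_lt (by omega)]) fun V₅ h₅ r₅ f₅ => ?_
      exact ⟨h₅, r₅, f₅.out⟩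
    rintro t₅ V₅ ⟨ht₅, h₅, j₅, o₅⟩
    have hcost'' : (Cmd.op (R := 31) (K := 6) .add 24 24 2).cost = 1 := rfl
    refine (ih h₅ (by omega) (by omega)).mono ?_
    rintro t₆ V₆ ⟨h₆, l₆, o₆, n₆, m₆, ht₆⟩
    rw [j₅] at m₆
    -- Each round outputs at least one element, which pays for the constant overhead of the round;
    -- this gives time linear in the number of elements.
    have hpos : 0 < l₂.length + l₄.length := by
      by_contra h0
      have e₂ : l₂ = [] := List.length_eq_zero_iff.1 (by omega)
      have e₄ : l₄ = [] := List.length_eq_zero_iff.1 (by omega)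
      refine hne ⟨?_, ?_⟩
      · by_contra hx
        obtain ⟨i, hi, -, hi', -⟩ := lowest_bit hx
        have hiw : i < w := (Nat.pow_lt_pow_iff_right (by norm_num)).1
          (hi'.trans_lt (fstWord_lt hww hA hB hcN))
        have := (m₂ (w * c + i)).2 (by
          rw [Nat.mul_add_div (by omega), Nat.div_eq_of_lt hiw, Nat.mul_add_mod,
            Nat.mod_eq_of_lt hiw]
          exact ⟨rfl, hi⟩)
        simp [e₂] at this
      · by_contra hx
        obtain ⟨i, hi, -, hi', -⟩ := lowest_bit hx
        have hiw : i < w := (Nat.pow_lt_pow_iff_right (by norm_num)).1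
          (hi'.trans_lt (sndWord_lt hww hB hcN))
        have := (m₄ (w * (N + c) + i)).2 (by
          rw [Nat.mul_add_div (by omega), Nat.div_eq_of_lt hiw, Nat.mul_add_mod,
            Nat.mod_eq_of_lt hiw]
          exact ⟨rfl, hi⟩)
        simp [e₄] at this
    -- An element is output exactly in the round numbered by the mate of its block, so different
    -- rounds have disjoint outputs.
    have key : ∀ v, (v ∈ l₄ ∨ v ∈ l₂) ↔ (v / w < 2 * N ∧
        (bitWord A B N μ (v / w)).testBit (v % w) = true) ∧
          mate A N μ (blockOf N (v / w)) = j := by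
      intro v
      rw [m₂, m₄]
      constructor
      · rintro (⟨e, hb⟩ | ⟨e, hb⟩)
        · rw [e, bitWord_snd]
          refine ⟨⟨by omega, hb⟩, ?_⟩
          rw [(blockOf_eq_iff (by omega) hcN).2 (.inr rfl), hcj]
        · rw [e, bitWord_fst hcN]
          refine ⟨⟨by omega, hb⟩, ?_⟩
          rw [(blockOf_eq_iff (by omega) hcN).2 (.inl rfl), hcj]
      · rintro ⟨⟨h1, hb⟩, e⟩
        have e' : blockOf N (v / w) = c := by
          rw [hc, ← e, mate_mate A (blockOf_lt h1)]
        rcases (blockOf_eq_iff h1 hcN).1 e' with e'' | e''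
        · rw [e'', bitWord_fst hcN] at hb
          exact .inr ⟨e'', hb⟩
        · rw [e'', bitWord_snd] at hb
          exact .inl ⟨e'', hb⟩
    refine ⟨h₆, l₆ ++ (l₄ ++ l₂), ?_, ?_, fun v => ?_, ?_⟩
    · rw [o₆, o₅, o₄, o₃]; simp
    · rw [List.nodup_append, List.nodup_append]
      refine ⟨n₆, ⟨n₄, n₂, fun v hv u hu e => ?_⟩, fun v hv u hu e => ?_⟩
      · subst e
        have h1 := (m₄ _).1 hv
        have h2 := (m₂ _).1 hu
        omega
      · subst e
        have h1 := (m₆ _).1 hv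
        have h2 := (key _).1 (List.mem_append.1 hu)
        omega
    · rw [List.mem_append, List.mem_append, key, m₆, ← and_or_left]
      refine and_congr_right fun _ => ?_
      omega
    · simp only [List.length_append]
      omega

end

/-! ### Correctness of search, findany and enumeration -/

section

variable {w L N μ : ℕ} {V : NatState 31} {A B : ℕ → ℕ} {κ : Fin 6 → BitVec w}
  {Q : NatState 31 → Prop} {S : Finset ℕ}

theorem wp_locateCmd (h : Stores w L N V A B μ) {i m : ℕ} (hi : V.reg 0 = i) (hiw : i < 2 ^ w)
    (hQ : ∀ V', Stores w L N V' A B μ → V'.reg 9 = i / w → V'.reg 14 = i % w →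
      V'.reg 10 = blockOf N (i / w) → Frame [9, 10, 14] V V' → Q V') :
    locateCmd.wp κ m Q V := by
  unfold locateCmd
  rw [Cmd.wp_seq]
  refine wp_op (v := i / w) h (by decide) (by rw [hi, h.width]; rfl) fun V₁ h₁ r₁ f₁ => ?_
  rw [Cmd.wp_seq]
  refine wp_op (v := i % w) h₁ (by decide) (by rw [f₁.reg 0 (by decide), hi, h₁.width]; rfl)
    fun V₂ h₂ r₂ f₂ => ?_
  have q₂ := (f₂.reg 9 (by decide)).trans r₁
  rw [Cmd.wp_ifLt, q₂, h₂.size]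
  split_ifs with c
  · refine wp_move h₂ (by decide) fun V₃ h₃ r₃ f₃ => ?_
    refine hQ V₃ h₃ ((f₃.reg 9 (by decide)).trans q₂) ((f₃.reg 14 (by decide)).trans r₂) ?_
      (((f₁.trans f₂).trans f₃).mono (by decide))
    rw [r₃, q₂, blockOf, if_pos c]
  · refine wp_op (v := i / w - N) h₂ (by decide) (by
      rw [q₂, h₂.size]
      exact natEval_sub ((Nat.div_le_self _ _).trans_lt hiw) (by omega)) fun V₃ h₃ r₃ f₃ => ?_
    refine hQ V₃ h₃ ((f₃.reg 9 (by decide)).trans q₂) ((f₃.reg 14 (by decide)).trans r₂) ?_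
      (((f₁.trans f₂).trans f₃).mono (by decide))
    rw [r₃, blockOf, if_neg c]

theorem bitWord_blockOf (q : ℕ) : bitWord A B N μ q =
    if q < N then fstWord A B N μ (blockOf N q) else sndWord A B N μ (blockOf N q) := by
  unfold bitWord blockOf
  split_ifs <;> rfl

theorem bitWord_lt {k : ℕ} (hk : 0 < k) (hA : ∀ b < N, A b < k) (hB : ∀ b < N, B b < k) {q : ℕ}
    (hq : q < 2 * N) : bitWord A B N μ q < k := by
  rw [bitWord_blockOf]
  split_ifs
  exacts [fstWord_lt hk hA hB (blockOf_lt hq), sndWord_lt hk hB (blockOf_lt hq)]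

theorem mem_of_testBit
    (hS : ∀ i, i ∈ S ↔ i / w < 2 * N ∧ (bitWord A B N μ (i / w)).testBit (i % w) = true)
    {q j : ℕ} (hq : q < 2 * N) (hlt : bitWord A B N μ q < 2 ^ w)
    (hj : (bitWord A B N μ q).testBit j = true) : q * w + j ∈ S := by
  have hjw : j < w := (Nat.pow_lt_pow_iff_right (by norm_num)).1
    ((Nat.ge_two_pow_of_testBit hj).trans_lt hlt)
  rw [hS, mul_comm, Nat.mul_add_div (by omega), Nat.div_eq_of_lt hjw, Nat.mul_add_mod,
    Nat.mod_eq_of_lt hjw]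
  exact ⟨hq, hj⟩

theorem wp_searchCmd (hN : 2 * N ≤ 2 ^ w) (h : Represents w L N V S) {i : ℕ} (hi : V.reg 0 = i)
    (hiw : i < 2 ^ w) (hiN : i / w < 2 * N) :
    searchCmd.wp κ (2 * N)
      (fun V' => Represents w L N V' S ∧ V'.reg 0 = if i ∈ S then 1 else 0) V := by
  obtain ⟨A, B, μ, h, hv, hS⟩ := h
  unfold searchCmd
  rw [Cmd.wp_seq]
  refine wp_locateCmd h hi hiw fun V₁ h₁ q₁ k₁ b₁ f₁ => ?_
  rw [Cmd.wp_seq]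
  refine wp_readCmd h₁ hN (b₁ ▸ blockOf_lt hiN) fun V₂ h₂ x₂ y₂ f₂ => ?_
  rw [b₁] at x₂ y₂
  rw [Cmd.wp_seq]
  refine wp_ifLt_join (Q' := fun V' => Stores w L N V' A B μ ∧
    V'.reg 0 = bitWord A B N μ (i / w) ∧ V'.reg 14 = i % w) (fun c => ?_) (fun c => ?_) ?_
  · rw [f₂.reg 9 (by decide), q₁, h₂.size] at c
    refine wp_move h₂ (by decide) fun V₃ h₃ r₃ f₃ => ⟨h₃, ?_, ?_⟩
    · rw [r₃, x₂, bitWord_blockOf, if_pos c]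
    · rw [(f₂.trans f₃).reg 14 (by decide), k₁]
  · rw [f₂.reg 9 (by decide), q₁, h₂.size] at c
    refine wp_move h₂ (by decide) fun V₃ h₃ r₃ f₃ => ⟨h₃, ?_, ?_⟩
    · rw [r₃, y₂, bitWord_blockOf, if_neg c]
    · rw [(f₂.trans f₃).reg 14 (by decide), k₁]
  rintro V₃ ⟨h₃, x₃, k₃⟩
  rw [Cmd.wp_seq]
  refine wp_op h₃ (by decide) (by rw [x₃, k₃, BinOp.natEval]) fun V₄ h₄ r₄ f₄ => ?_
  refine wp_op h₄ (by decide) (by rw [r₄, h₄.one, BinOp.natEval, Nat.and_one_is_mod])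
    fun V₅ h₅ r₅ f₅ => ⟨⟨A, B, μ, h₅, hv, hS⟩, ?_⟩
  rw [r₅]
  simp only [hS, hiN, true_and, Nat.testBit_eq_decide_div_mod_eq, decide_eq_true_eq]
  have := Nat.mod_two_eq_zero_or_one (bitWord A B N μ (i / w) / 2 ^ (i % w))
  split_ifs <;> omega

theorem wp_findanyCmd (hw : 16 ≤ w) (hN : 2 * N ≤ 2 ^ w)
    (hL : ∀ b < Nat.log 2 w, L / 2 ^ 2 ^ b % 2 ^ 2 ^ b = b) (h : Represents w L N V S)
    (hmem : ∀ a < 2 * N, V.mem a < 2 ^ w) (hSw : ∀ i ∈ S, i < 2 ^ w) :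
    findanyCmd.wp κ (2 * N)
      (fun V' => Represents w L N V' S ∧ (S = ∅ → V'.reg 0 = 0) ∧
        (S.Nonempty → V'.reg 0 ∈ S)) V := by
  obtain ⟨A, B, μ, h, hv, hS⟩ := h
  have hle := hv.le
  have hww : 0 < 2 ^ w := by positivity
  have hA : ∀ b < N, A b < 2 ^ w := fun b hb => h.fst b hb ▸ hmem b (by omega)
  have hB : ∀ b < N, B b < 2 ^ w := fun b hb => h.snd b hb ▸ hmem _ (by omega)
  have hbit : ∀ q < 2 * N, bitWord A B N μ q < 2 ^ w := fun q => bitWord_lt hww hA hB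
  have hSmem := fun q hq j => mem_of_testBit hS hq (hbit q hq) (j := j)
  rw [findanyCmd, Cmd.wp_ifEq, h.barrier, h.zero]
  split_ifs with c
  · have hS₀ : S = ∅ := by
      refine Finset.eq_empty_of_forall_notMem fun i hi => ?_
      have hi' := (hS i).1 hi
      have := mate_blockOf_lt (ne_zero_of_testBit hi'.2) hi'.1
      omega
    refine wp_move h (by decide) fun V₁ h₁ r₁ f₁ => ⟨⟨A, B, μ, h₁, hv, hS⟩, fun _ => ?_, ?_⟩
    · rw [r₁, h.zero]
    · rw [hS₀]; rintro ⟨x, hx⟩; simp at hx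
  · rw [Cmd.wp_seq]
    refine wp_move h (by decide) fun V₁ h₁ r₁ f₁ => ?_
    rw [h.zero] at r₁
    rw [Cmd.wp_seq]
    refine wp_pickCmd h₁ hN hle (by omega) fun V₂ h₂ c₂ x₂ y₂ f₂ => ?_
    rw [r₁] at c₂ x₂ y₂
    set k := mate A N μ 0 with hk
    have hkN : k < N := mate_lt (by omega)
    have hne := hv.ne_zero k hkN (by
      rw [hk, mate_mate A (by omega)]
      have := mate_cases A N μ 0
      omega)
    rw [Cmd.wp_seq]
    -- At least one of the two words of the block found is nonzero; `q` is the index of the one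
    -- used.
    refine wp_ifEq_join (Q' := fun V' => ∃ q < 2 * N, Stores w L N V' A B μ ∧ V'.reg 9 = q ∧
      V'.reg 11 = bitWord A B N μ q ∧ bitWord A B N μ q ≠ 0) (fun e => ?_) (fun e => ?_) ?_
    · rw [x₂, h₂.zero] at e
      rw [Cmd.wp_seq]
      refine wp_move h₂ (by decide) fun V₃ h₃ r₃ f₃ => ?_
      refine wp_op (v := N + k) h₃ (by decide) (by
        rw [f₃.reg 13 (by decide), c₂, h₃.size, BinOp.natEval, Nat.mod_eq_of_lt (by omega),
          Nat.add_comm]) fun V₄ h₄ r₄ f₄ => ⟨N + k, by omega, h₄, r₄, ?_⟩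
      rw [f₄.reg 11 (by decide), r₃, y₂, bitWord_snd]
      exact ⟨rfl, fun e' => hne ⟨e, e'⟩⟩
    · rw [x₂, h₂.zero] at e
      refine wp_move h₂ (by decide) fun V₃ h₃ r₃ f₃ => ⟨k, by omega, h₃, r₃.trans c₂, ?_⟩
      rw [f₃.reg 11 (by decide), x₂, bitWord_fst hkN]
      exact ⟨rfl, e⟩
    rintro V₃ ⟨q, hq, h₃, q₃, x₃, hx⟩
    rw [Cmd.wp_seq]
    refine wp_elementCmd h₃ hw hL x₃ q₃ hx (hbit q hq) (fun j hj => hSw _ (hSmem q hq j hj))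
      fun V₄ j h₄ hj _ _ _ r₄ f₄ => ?_
    refine wp_move h₄ (by decide) fun V₅ h₅ r₅ f₅ => ⟨⟨A, B, μ, h₅, hv, hS⟩, ?_, fun _ => ?_⟩
    · intro hS₀
      have := hSmem q hq j hj
      simp [hS₀] at this
    · rw [r₅, r₄]
      exact hSmem q hq j hj

theorem triple_enumerateCmd (hw : 16 ≤ w) (hN : 2 * N ≤ 2 ^ w)
    (hL : ∀ b < Nat.log 2 w, L / 2 ^ 2 ^ b % 2 ^ 2 ^ b = b) (h : Represents w L N V S)
    (hout : V.out = [])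
    (hmem : ∀ a < 2 * N, V.mem a < 2 ^ w) (hSw : ∀ i ∈ S, i < 2 ^ w) :
    Triple κ (2 * N) enumerateCmd V fun t V' => t ≤ 200 * (S.card + 1) ∧
      Represents w L N V' S ∧ V'.out.Nodup ∧ V'.out.toFinset = S := by
  obtain ⟨A, B, μ, h, hv, hS⟩ := h
  have hww : 0 < 2 ^ w := by positivity
  have hA : ∀ b < N, A b < 2 ^ w := fun b hb => h.fst b hb ▸ hmem b (by omega)
  have hB : ∀ b < N, B b < 2 ^ w := fun b hb => h.snd b hb ▸ hmem _ (by omega)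
  have hbit : ∀ q < 2 * N, bitWord A B N μ q < 2 ^ w := fun q => bitWord_lt hww hA hB
  have hSmem := fun q hq j => mem_of_testBit hS hq (hbit q hq) (j := j)
  refine .seq ((Triple.of_wp (Q := fun V' => Stores w L N V' A B μ ∧ V'.reg 24 = 0 ∧
    V'.out = []) ?_).mono ?_)
  · exact wp_move h (by decide) fun V₁ h₁ r₁ f₁ => ⟨h₁, r₁.trans h.zero, f₁.out.trans hout⟩
  rintro t₁ V₁ ⟨ht₁, h₁, r₁, o₁⟩
  have hcost : (move (24 : Fin 32) 1).cost = 1 := rfl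
  refine (triple_enumerate_loop hw hN hL hA hB hv
    (fun q hq j hj => hSw _ (hSmem q hq j hj)) h₁ (by omega)).mono ?_
  rintro t₂ V₂ ⟨h₂, l, hl, hn, hm, ht⟩
  rw [o₁, List.append_nil] at hl
  have hf : l.toFinset = S := by
    ext v
    rw [List.mem_toFinset, hm, hS, r₁]
    simp
  rw [hl]
  refine ⟨?_, ⟨A, B, μ, h₂, hv, hS⟩, hn, hf⟩
  rw [← hf, List.toFinset_card_of_nodup hn]
  omega

end

/-! ### Insertion, deletion and initialization -/

section

variable {w L N μ : ℕ} {V : NatState 31} {A B : ℕ → ℕ} {κ : Fin 6 → BitVec w}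
  {Q : NatState 31 → Prop} {S : Finset ℕ}

theorem or_eq_zero_iff {x y : ℕ} : x ||| y = 0 ↔ x = 0 ∧ y = 0 := by
  constructor
  · intro h
    have h₁ : x ≤ x ||| y := Nat.left_le_or
    have h₂ : y ≤ x ||| y := Nat.right_le_or
    omega
  · rintro ⟨rfl, rfl⟩; rfl

/-- A program that changes the word in register `d` by the function `g` of this word and of the
word in register `14`. -/
def Changes (κ : Fin 6 → BitVec w) (m : ℕ) (e : Fin 32 → Cmd 31 6) (g : ℕ → ℕ → ℕ) : Prop :=
  ∀ (d : Fin 32) (L N μ : ℕ) (V : NatState 31) (A B : ℕ → ℕ) (Q : NatState 31 → Prop),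
    8 < d → d ≠ 14 → Stores w L N V A B μ →
    (∀ V', Stores w L N V' A B μ → V'.reg d = g (V.reg d) (V.reg 14) → Frame [d] V V' → Q V') →
    (e d).wp κ m Q V

/-- The block is emptied if it was nonempty, changed in registers, and filled again if the result is
nonzero. Hence changes that create, keep or destroy a nonempty block need no separate treatment, and
`g` is arbitrary. -/
theorem wp_updateCmd {e : Fin 32 → Cmd 31 6} {g : ℕ → ℕ → ℕ} (he : Changes κ (2 * N) e g)
    (hN : 2 * N ≤ 2 ^ w) (h : Stores w L N V A B μ) (hv : Valid A B N μ) (hw : 0 < w)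
    {i : ℕ} (hi : V.reg 0 = i) (hiw : i < 2 ^ w) (hiN : i / w < 2 * N) :
    (updateCmd e).wp κ (2 * N) (fun V' => ∃ A' B' μ', Stores w L N V' A' B' μ' ∧ Valid A' B' N μ' ∧
      ∀ q < 2 * N, bitWord A' B' N μ' q =
        if q = i / w then g (bitWord A B N μ q) (2 ^ (i % w)) else bitWord A B N μ q) V := by
  unfold updateCmd
  rw [Cmd.wp_seq]
  refine wp_locateCmd h hi hiw fun V₁ h₁ q₁ k₁ b₁ f₁ => ?_
  set b := blockOf N (i / w) with hb
  have hbN : b < N := blockOf_lt hiN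
  rw [Cmd.wp_seq]
  refine wp_op (v := 2 ^ (i % w)) h₁ (by decide) (by
    rw [k₁, h₁.one, BinOp.natEval, one_mul, Nat.mod_eq_of_lt]
    exact Nat.pow_lt_pow_right (by norm_num) (Nat.mod_lt _ hw)) fun V₂ h₂ k₂ f₂ => ?_
  have b₂ := (f₂.reg 10 (by decide)).trans b₁
  have q₂ := (f₂.reg 9 (by decide)).trans q₁
  rw [Cmd.wp_seq]
  refine wp_readCmd h₂ hN (b₂ ▸ hbN) fun V₃ h₃ x₃ y₃ f₃ => ?_
  rw [b₂] at x₃ y₃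
  rw [Cmd.wp_seq]
  refine wp_op (v := V₃.reg 11 ||| V₃.reg 12) h₃ (by decide) rfl fun V₄ h₄ r₄ f₄ => ?_
  have g₄ := f₃.trans f₄
  have b₄ := (g₄.reg 10 (by decide)).trans b₂
  have k₄ := (g₄.reg 14 (by decide)).trans k₂
  have q₄ := (g₄.reg 9 (by decide)).trans q₂
  have x₄ := (f₄.reg 11 (by decide)).trans x₃
  have y₄ := (f₄.reg 12 (by decide)).trans y₃
  rw [x₃, y₃] at r₄
  rw [Cmd.wp_seq]
  refine wp_ifEq_join (Q' := fun V' => ∃ A' B' μ', Stores w L N V' A' B' μ' ∧ Valid A' B' N μ' ∧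
    (∀ c < N, fstWord A' B' N μ' c = (if c = b then 0 else fstWord A B N μ c) ∧
      sndWord A' B' N μ' c = if c = b then 0 else sndWord A B N μ c) ∧
    Frame [8, 13, 15, 16, 17, 19, 20, 30, 31] V₄ V') (fun c => ?_) (fun c => ?_) ?_
  · rw [r₄, h₄.zero, or_eq_zero_iff] at c
    refine ⟨A, B, μ, h₄, hv, fun c' _ => ?_, Frame.mono (l := []) ⟨fun _ _ => rfl, rfl⟩ (by simp)⟩
    constructor
    · split_ifs with e
      · rw [e, c.1]
      · rfl
    · split_ifs with e
      · rw [e, c.2]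
      · rfl
  · rw [r₄, h₄.zero, Ne, or_eq_zero_iff] at c
    refine wp_removeCmd h₄ hN (pos_of_ne_zero c) hv.le (b₄ ▸ hbN) fun V₅ h₅ f₅ => ?_
    rw [b₄] at h₅
    exact ⟨_, _, _, h₅, hv.remove hbN c, fun c' hc' => words_remove hv hbN hc' c, f₅⟩
  rintro V₅ ⟨A₅, B₅, μ₅, h₅, hv₅, hw₅, f₅⟩
  have b₅ := (f₅.reg 10 (by decide)).trans b₄
  have k₅ := (f₅.reg 14 (by decide)).trans k₄
  have q₅ := (f₅.reg 9 (by decide)).trans q₄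
  have x₅ := (f₅.reg 11 (by decide)).trans x₄
  have y₅ := (f₅.reg 12 (by decide)).trans y₄
  rw [Cmd.wp_seq]
  refine wp_ifLt_join (Q' := fun V' => Stores w L N V' A₅ B₅ μ₅ ∧ V'.reg 10 = b ∧
    V'.reg 11 = (if i / w < N then g (fstWord A B N μ b) (2 ^ (i % w)) else fstWord A B N μ b) ∧
    V'.reg 12 = if i / w < N then sndWord A B N μ b else g (sndWord A B N μ b) (2 ^ (i % w)))
    (fun c => ?_) (fun c => ?_) ?_
  · rw [q₅, h₅.size] at c
    refine he 11 L N μ₅ V₅ A₅ B₅ _ (by decide) (by decide) h₅ fun V₆ h₆ r₆ f₆ => ⟨h₆, ?_, ?_, ?_⟩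
    · rw [f₆.reg 10 (by decide), b₅]
    · rw [r₆, x₅, k₅, if_pos c]
    · rw [f₆.reg 12 (by decide), y₅, if_pos c]
  · rw [q₅, h₅.size] at c
    refine he 12 L N μ₅ V₅ A₅ B₅ _ (by decide) (by decide) h₅ fun V₆ h₆ r₆ f₆ => ⟨h₆, ?_, ?_, ?_⟩
    · rw [f₆.reg 10 (by decide), b₅]
    · rw [f₆.reg 11 (by decide), x₅, if_neg c]
    · rw [r₆, y₅, k₅, if_neg c]
  rintro V₆ ⟨h₆, b₆, x₆, y₆⟩
  rw [Cmd.wp_seq]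
  refine wp_op (v := V₆.reg 11 ||| V₆.reg 12) h₆ (by decide) rfl fun V₇ h₇ r₇ f₇ => ?_
  have b₇ := (f₇.reg 10 (by decide)).trans b₆
  have x₇ := (f₇.reg 11 (by decide)).trans x₆
  have y₇ := (f₇.reg 12 (by decide)).trans y₆
  rw [x₆, y₆] at r₇
  -- After the removal block `b` is zero and the others are as before; it remains to prescribe the
  -- two words of `b`.
  have final : ∀ A' B' μ', (∀ c < N, fstWord A' B' N μ' c =
      (if c = b then V₇.reg 11 else fstWord A₅ B₅ N μ₅ c) ∧
      sndWord A' B' N μ' c = if c = b then V₇.reg 12 else sndWord A₅ B₅ N μ₅ c) →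
      ∀ q < 2 * N, bitWord A' B' N μ' q =
        if q = i / w then g (bitWord A B N μ q) (2 ^ (i % w)) else bitWord A B N μ q := by
    intro A' B' μ' hw' q hq
    have e₁ := hw' (blockOf N q) (blockOf_lt hq)
    have e₂ := hw₅ (blockOf N q) (blockOf_lt hq)
    rw [bitWord_blockOf, bitWord_blockOf, e₁.1, e₁.2, e₂.1, e₂.2, x₇, y₇]
    clear_value b
    unfold blockOf at *
    grind
  rw [Cmd.wp_ifEq, h₇.zero, r₇]
  have hfst : fstWord A₅ B₅ N μ₅ b = 0 := by rw [(hw₅ b hbN).1, if_pos rfl]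
  have hsnd : sndWord A₅ B₅ N μ₅ b = 0 := by rw [(hw₅ b hbN).2, if_pos rfl]
  rw [← x₇, ← y₇, if_congr or_eq_zero_iff rfl rfl]
  split_ifs with c
  · refine ⟨A₅, B₅, μ₅, h₇, hv₅, final _ _ _ fun c' _ => ?_⟩
    rw [c.1, c.2]
    constructor
    · split_ifs with e
      · rw [e, hfst]
      · rfl
    · split_ifs with e
      · rw [e, hsnd]
      · rfl
  · refine wp_addCmd h₇ hN (hv₅.lt_of_eq_zero hbN hfst hsnd) (b₇ ▸ hbN) fun V₈ h₈ f₈ => ?_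
    rw [b₇] at h₈
    exact ⟨_, _, _, h₈, hv₅.add hbN hfst hsnd c,
      final _ _ _ fun c' hc' => words_add hv₅ hbN hc' hfst hsnd⟩

theorem wp_insertCmd (hN : 2 * N ≤ 2 ^ w) (h : Represents w L N V S) (hw : 0 < w) {i : ℕ}
    (hi : V.reg 0 = i) (hiw : i < 2 ^ w) (hiN : i / w < 2 * N) :
    insertCmd.wp κ (2 * N) (fun V' => Represents w L N V' (insert i S)) V := by
  obtain ⟨A, B, μ, h, hv, hS⟩ := h
  refine Cmd.wp_mono (wp_updateCmd (g := fun x y => x ||| y) (e := fun d => .op .or d d 14)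
    (fun d L N μ V A B Q hd _ h hQ => wp_op h (.inr hd) rfl hQ) hN h hv hw hi hiw hiN) ?_
  rintro V' ⟨A', B', μ', h', hv', hw'⟩
  refine ⟨A', B', μ', h', hv', fun v => ?_⟩
  rw [Finset.mem_insert, hS]
  by_cases hq : v / w < 2 * N
  · rw [hw' _ hq]
    split_ifs with e
    · rw [Nat.testBit_or, Nat.testBit_two_pow, Bool.or_eq_true, decide_eq_true_eq]
      have : v = i ↔ i % w = v % w := by
        refine ⟨fun h => by rw [h], fun h' => ?_⟩
        rw [← Nat.div_add_mod v w, ← Nat.div_add_mod i w, e, h']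
      tauto
    · have : v ≠ i := fun h => e (by rw [h])
      tauto
  · have : v ≠ i := fun h => hq (by rwa [h])
    tauto

/-- There is no complement instruction: setting the bit first makes the exclusive or clear it. -/
theorem wp_deleteCmd (hN : 2 * N ≤ 2 ^ w) (h : Represents w L N V S) (hw : 0 < w) {i : ℕ}
    (hi : V.reg 0 = i) (hiw : i < 2 ^ w) (hiN : i / w < 2 * N) :
    deleteCmd.wp κ (2 * N) (fun V' => Represents w L N V' (S.erase i)) V := by
  obtain ⟨A, B, μ, h, hv, hS⟩ := h
  refine Cmd.wp_mono (wp_updateCmd (g := fun x y => (x ||| y) ^^^ y)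
    (e := fun d => .op .or d d 14 ;; .op .xor d d 14)
    (fun d L N μ V A B Q hd hd' h hQ => ?_) hN h hv hw hi hiw hiN) ?_
  · rw [Cmd.wp_seq]
    refine wp_op h (.inr hd) rfl fun V₁ h₁ r₁ f₁ => wp_op h₁ (.inr hd) rfl fun V₂ h₂ r₂ f₂ => ?_
    refine hQ V₂ h₂ ?_ ((f₁.trans f₂).mono (by simp))
    rw [r₂, r₁, f₁.reg 14 (by simpa using hd'.symm)]
    rfl
  rintro V' ⟨A', B', μ', h', hv', hw'⟩
  refine ⟨A', B', μ', h', hv', fun v => ?_⟩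
  rw [Finset.mem_erase, hS]
  by_cases hq : v / w < 2 * N
  · rw [hw' _ hq]
    split_ifs with e
    · rw [Nat.testBit_xor, Nat.testBit_or, Nat.testBit_two_pow]
      have : v = i ↔ i % w = v % w := by
        refine ⟨fun h => by rw [h], fun h' => ?_⟩
        rw [← Nat.div_add_mod v w, ← Nat.div_add_mod i w, e, h']
      by_cases hm : i % w = v % w
      · simp [hm, this.2 hm]
      · simp [hm, mt this.1 hm]
    · have : v ≠ i := fun h => e (by rw [h])
      tauto
  · tauto

/-- With the barrier at `0` no pair can straddle it, so every block lies behind it, is its own mate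
and counts as empty, whatever the memory contains. Only registers have to be set. -/
theorem wp_setupCmd {n N : ℕ} (hw : 16 ≤ w) (hn : n < 2 ^ w) (hN : N = n / (2 * w) + 1)
    (hκ : ∀ k, (κ k).toNat = ![0, 1, w, 2 ^ Nat.log 2 w - 1, Nat.log 2 w, L] k) {m : ℕ}
    (hV : V.reg 0 = n) :
    setupCmd.wp κ m (fun V' => Represents w L N V' ∅) V := by
  have hww : 2 * w < 2 ^ w := by
    obtain ⟨k, rfl⟩ : ∃ k, w = k + 1 := ⟨w - 1, by omega⟩
    have : k + 1 ≤ 2 ^ k := Nat.lt_two_pow_self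
    have : k + 1 < 2 ^ k := by
      obtain ⟨j, rfl⟩ : ∃ j, k = j + 1 := ⟨k - 1, by omega⟩
      have : j < 2 ^ j := Nat.lt_two_pow_self
      rw [pow_succ]; omega
    rw [pow_succ]; omega
  have hdiv : n / (2 * w) + 1 < 2 ^ w := by
    have : n / (2 * w) ≤ n / 32 := Nat.div_le_div_left (by omega) (by norm_num)
    omega
  have e₁ : (w + w) % 2 ^ w = 2 * w := by rw [Nat.mod_eq_of_lt] <;> omega
  have e₂ : (n / (2 * w) + 1) % 2 ^ w = N := by rw [Nat.mod_eq_of_lt hdiv, hN]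
  simp only [setupCmd, Cmd.wp, hκ, BinOp.natEval]
  refine ⟨V.mem, fun b => V.mem (N + b), 0, ?_, ?_, ?_⟩
  · constructor <;> simp [hV, e₁, e₂]
  · refine ⟨by omega, fun b _ h => ?_⟩
    have := mate_cases V.mem N 0 b
    omega
  · intro i
    have : ∀ b, mate V.mem N 0 b = b := fun b => by
      have := mate_cases V.mem N 0 b
      omega
    simp [bitWord, fstWord, sndWord, this]

end

/-! ### Assembling the data structure -/

def findanyPrograms : SetPrograms 31 6 where
  setup := setupCmd.program
  insert := insertCmd.program
  delete := deleteCmd.program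
  search := searchCmd.program
  findany := findanyCmd.program
  enumerate := enumerateCmd.program

section

variable {w L N m : ℕ} {κ : Fin 6 → BitVec w}

/-- The workspace `s` represents the set `S`. -/
def Holds (w L N m : ℕ) (s : State w 31 m) (S : Finset ℕ) : Prop :=
  ∃ V : NatState 31, V.Models s ([] : List (BitVec w)) ∧ Represents w L N V S

/-- Register `0` carries arguments and results and the output is not part of the data, so neither
affects the set represented. -/
theorem Represents.congr {V V' : NatState 31} {S : Finset ℕ} (h : Represents w L N V S)
    (hr : ∀ d, d ≠ 0 → V'.reg d = V.reg d) (hm : V'.mem = V.mem) : Represents w L N V' S := by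
  obtain ⟨A, B, μ, h, hv, hS⟩ := h
  refine ⟨A, B, μ, ?_, hv, hS⟩
  constructor
  case fst => rw [hm]; exact h.fst
  case snd => rw [hm]; exact h.snd
  all_goals rw [hr _ (by decide)]
  exacts [h.zero, h.one, h.width, h.ones, h.log, h.table, h.size, h.barrier]

theorem completes_of_triple {c : Cmd 31 6} {T : ℕ} {s : State w 31 m} {x : BitVec w}
    {S S' : Finset ℕ} {P : ℕ → List ℕ → Prop} (hs : Holds w L N m s S)
    (h : ∀ V : NatState 31, Represents w L N V S → V.reg 0 = x.toNat → V.out = [] →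
      (∀ a < m, V.mem a < 2 ^ w) →
      Triple κ m c V fun t V' => t ≤ T ∧ Represents w L N V' S' ∧ P (V'.reg 0) V'.out) :
    Completes κ c.program T s x fun s' o =>
      Holds w L N m s' S' ∧ P s'.result (o.map BitVec.toNat) := by
  obtain ⟨V, hV, hS⟩ := hs
  refine Triple.completes (V := V.setReg 0 x.toNat) ⟨fun i => ?_, hV.mem, hV.out⟩
    (.of_lt fun _ hmem => (h (V.setReg 0 x.toNat) (hS.congr (fun d hd => by simp [hd]) rfl)
      (by simp) hV.out.symm hmem).mono ?_)
  · by_cases hi : i = 0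
    · subst hi; simp [call]
    · simp [call, hi, hV.reg]
  · rintro t V' ⟨ht, hS', hP⟩
    refine ⟨ht, fun s' o hs' => ⟨⟨{ V' with out := [] }, ⟨hs'.reg, hs'.mem, rfl⟩,
      hS'.congr (fun _ _ => rfl) rfl⟩, ?_⟩⟩
    rw [State.result, hs'.reg, hs'.out]
    exact hP

theorem completes_of_wp {c : Cmd 31 6} {T : ℕ} {s : State w 31 m} {x : BitVec w}
    {S S' : Finset ℕ} {P : ℕ → Prop} (hs : Holds w L N m s S) (hT : c.cost ≤ T)
    (h : ∀ V : NatState 31, Represents w L N V S → V.reg 0 = x.toNat →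
      (∀ a < m, V.mem a < 2 ^ w) →
      c.wp κ m (fun V' => Represents w L N V' S' ∧ P (V'.reg 0)) V) :
    Completes κ c.program T s x fun s' _ => Holds w L N m s' S' ∧ P s'.result :=
  completes_of_triple (P := fun x _ => P x) hs fun V hV hx _ hmem =>
    (Triple.of_wp (h V hV hx hmem)).mono fun _ _ h' => ⟨h'.1.trans hT, h'.2⟩

theorem Completes.mono {R K T : ℕ} {κ : Fin K → BitVec w} {P : Program R K} {s : State w R m}
    {x : BitVec w} {p q : State w R m → List (BitVec w) → Prop} (h : Completes κ P T s x p)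
    (hpq : ∀ s' o, p s' o → q s' o) : Completes κ P T s x q := by
  obtain ⟨t, ht, c, h₁, h₂, h₃⟩ := h
  exact ⟨t, ht, c, h₁, h₂, hpq _ _ h₃⟩

theorem maintains_findanyPrograms {n : ℕ} (hw : 16 ≤ w) (hn : n < 2 ^ w)
    (hκ : ∀ k, (κ k).toNat = ![0, 1, w, 2 ^ Nat.log 2 w - 1, Nat.log 2 w, L] k)
    (hL : ∀ b < Nat.log 2 w, L / 2 ^ 2 ^ b % 2 ^ 2 ^ b = b) :
    findanyPrograms.Maintains κ n (2 * (n / (2 * w) + 1)) 1000 := by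
  set N := n / (2 * w) + 1 with hNdef
  have hN : 2 * N ≤ 2 ^ w := by
    have h₁ : n / (2 * w) ≤ n / 32 := Nat.div_le_div_left (by omega) (by norm_num)
    have h₂ : 2 ^ 16 ≤ 2 ^ w := Nat.pow_le_pow_right two_pos hw
    omega
  have hin : ∀ i ∈ Finset.Icc 1 n, i < 2 ^ w ∧ i / w < 2 * N := by
    intro i hi
    rw [Finset.mem_Icc] at hi
    refine ⟨by omega, ?_⟩
    rw [Nat.div_lt_iff_lt_mul (by omega)]
    -- The strict inequality `n < 2 * w * N` accommodates bit `n`; bit `0` belongs to no element.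
    have := Nat.lt_mul_div_succ n (show 0 < 2 * w by omega)
    rw [← hNdef] at this
    calc i < 2 * w * N := by omega
      _ = 2 * N * w := by ring
  have hof : ∀ {i}, i < 2 ^ w → (BitVec.ofNat w i).toNat = i := fun h => by
    rw [BitVec.toNat_ofNat, Nat.mod_eq_of_lt h]
  refine ⟨Holds w L N _, fun s => ?_, fun S s hSn hs => ⟨fun i hi => ?_, fun i hi => ?_,
    fun i hi => ?_, ?_, ?_⟩⟩
  · refine Triple.completes (V := ⟨fun i => ((call s (BitVec.ofNat w n)).state.reg i).toNat,
      fun a => if h : a < 2 * N then (s.mem ⟨a, h⟩).toNat else 0, []⟩)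
      ⟨fun _ => rfl, fun a => by simp [call], rfl⟩
      ((Triple.of_wp (wp_setupCmd hw hn hNdef hκ ?_)).mono ?_)
    · simp [call, Nat.mod_eq_of_lt hn]
    · rintro t V' ⟨ht, hV'⟩
      exact ⟨ht.trans (by decide), fun s' o hs' => ⟨{ V' with out := [] },
        ⟨hs'.reg, hs'.mem, rfl⟩, hV'.congr (fun _ _ => rfl) rfl⟩⟩
  · refine (completes_of_wp (P := fun _ => True) hs (by decide) fun V hV hx _ => ?_).mono
      fun _ _ h => h.1
    rw [hof (hin i hi).1] at hx
    exact Cmd.wp_mono (wp_insertCmd hN hV (by omega) hx (hin i hi).1 (hin i hi).2)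
      fun _ h => ⟨h, trivial⟩
  · refine (completes_of_wp (P := fun _ => True) hs (by decide) fun V hV hx _ => ?_).mono
      fun _ _ h => h.1
    rw [hof (hin i hi).1] at hx
    exact Cmd.wp_mono (wp_deleteCmd hN hV (by omega) hx (hin i hi).1 (hin i hi).2)
      fun _ h => ⟨h, trivial⟩
  · refine completes_of_wp (P := fun x => x = if i ∈ S then 1 else 0) hs (by decide)
      fun V hV hx _ => ?_
    rw [hof (hin i hi).1] at hx
    exact wp_searchCmd hN hV hx (hin i hi).1 (hin i hi).2
  · exact completes_of_wp (P := fun x => (S = ∅ → x = 0) ∧ (S.Nonempty → x ∈ S)) hs (by decide)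
      fun V hV _ hmem => wp_findanyCmd hw hN hL hV hmem fun i hi => (hin i (hSn hi)).1
  · exact completes_of_triple (P := fun _ o => o.Nodup ∧ o.toFinset = S) hs
      fun V hV _ hout hmem => (triple_enumerateCmd hw hN hL hV hout hmem
        fun i hi => (hin i (hSn hi)).1).mono fun t V' h => ⟨h.1.trans (by omega), h.2⟩

end

end WordRAM

theorem mainTheorem2 :
    ∃ (R K T w₀ : ℕ) (D : WordRAM.SetPrograms R K) (r : ℕ → ℕ),
      (fun n => (r n : ℝ)) =o[atTop] (fun n => (n : ℝ)) ∧
      ∀ w : ℕ, w₀ ≤ w → ∃ κ : Fin K → BitVec w,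
        ∀ n : ℕ, n < 2 ^ w → ∃ m : ℕ,
          (R + 1 + K + m) * w ≤ n + r n + T * w ∧ D.Maintains κ n m T := by
  -- The bound `w ≥ 16` gives `Nat.log 2 w ≥ 4`, as `log_formula` needs. No redundancy beyond whole
  -- words occurs, so `r = 0`: rounding up to blocks adds at most `2 * w` bits to `n`, and registers
  -- and constants take `38` words. The value `1000` is a generous time bound.
  refine ⟨31, 6, 1000, 16, WordRAM.findanyPrograms, fun _ => 0, ?_, fun w hw => ?_⟩
  · simp
  obtain ⟨L, hLw, hL⟩ := WordRAM.exists_log_table (Nat.log 2 w)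
  have hlog : 2 ^ Nat.log 2 w ≤ w := Nat.pow_log_le_self 2 (by omega)
  have hlog' : Nat.log 2 w < 2 ^ Nat.log 2 w := Nat.lt_two_pow_self
  have hww : w < 2 ^ w := Nat.lt_two_pow_self
  have hLw' : L < 2 ^ w := hLw.trans_le (Nat.pow_le_pow_right two_pos hlog)
  -- The constants are `0`, `1`, the word size, and for `s = Nat.log 2 w` the modulus `2 ^ s - 1`,
  -- `s` and the table. The table has at most `2 ^ s ≤ w` bits and so fits into one word.
  refine ⟨fun k => BitVec.ofNat w
    ((![0, 1, w, 2 ^ Nat.log 2 w - 1, Nat.log 2 w, L] : Fin 6 → ℕ) k), fun n hn =>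
    ⟨2 * (n / (2 * w) + 1), ?_, WordRAM.maintains_findanyPrograms hw hn (fun k => ?_) hL⟩⟩
  · have := Nat.div_mul_le_self n (2 * w)
    nlinarith
  · rw [BitVec.toNat_ofNat, Nat.mod_eq_of_lt]
    fin_cases k <;> simp <;> omega
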